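/- Let $G$ be a group of type FP, that is, the trivial module $\mathbb{Z}$ has a projective resolution of finite length by finitely generated $\mathbb{Z}G$-modules. Let $1\neq c\in Z(G)$ be a nontrivial central element and suppose that $\Gamma=G/\langle c\rangle$ is of type VFP, that is, $\Gamma$ has torsion-free subgroups of finite index, and all of these are of type FP. A module is of type $\mathrm{FP}_\infty$ if it has a projective resolution of finite type, i.e. with all terms finitely generated. A resolution $(M_j,\partial_j)_{j\ge 0}$ is $2$-periodic in degrees $\ge m$ if there are isomorphisms $M_j\cong M_{j+2}$ for all $j\ge m$ (with $j \ge 0$) that are compatible with the differentials between these modules. (a) Let $N$ be a $\mathbb{Z}\Gamma$-module of type $\mathrm{FP}_\infty$. Then $n=\mathrm{pd}_{\mathbb{Z}G}(N)$ is finite, and $N$ has a finite type $\mathbb{Z}\Gamma$-projective resolution that is $2$-periodic in degrees $\ge n-1$. (b) Suppose moreover that $G$ is of type FL, that is, the trivial module $\mathbb{Z}$ has a resolution of finite length by finitely generated free $\mathbb{Z}G$-modules. Then the Euler characteristic $\chi(G)$ is $0$ (where $\chi(G)=\sum_i(-1)^i\,\mathrm{rank}_{\mathbb{Z}}(\mathbb{Z}\otimes_{\mathbb{Z}G}P_i)$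 for any finite type, finite length $\mathbb{Z}G$-projective resolution $P_\bullet\to\mathbb{Z}$), $n=\mathrm{cd}(G)=\mathrm{pd}_{\mathbb{Z}G}(\mathbb{Z})$ is finite, and $\mathbb{Z}$ has a finite type free $\mathbb{Z}G$-resolution of length $n$. For every such resolution $F_\bullet\to\mathbb{Z}$ of length $n$, \[ r:=\sum_{i\ \mathrm{even}}\mathrm{rank}_{\mathbb{Z}G}(F_i)=\sum_{i\ \mathrm{odd}}\mathrm{rank}_{\mathbb{Z}G}(F_i), \] and the trivial $\mathbb{Z}\Gamma$-module $\mathbb{Z}$ has a finite type free $\mathbb{Z}\Gamma$-resolution $M_\bullet$ that is $2$-periodic in degrees $\ge n-1$ with $M_j\cong(\mathbb{Z}\Gamma)^r$ for all $j\ge n-1$ (with $j\ge 0$). -/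

import Mathlib

open CategoryTheory

universe u

namespace CentralQuotient

section Resolutions

variable {R : Type u} [Ring R] {N : ModuleCat.{u} R}

/-- A resolution is of finite type if every term is a finitely generated module. -/
def IsFiniteType (P : ProjectiveResolution N) : Prop :=
  ∀ i, Module.Finite R (P.complex.X i)

/-- A resolution has length at most `n` if its terms vanish in all degrees above `n`. -/
def LengthLE (P : ProjectiveResolution N) (n : ℕ) : Prop :=
  ∀ i, n < i → Limits.IsZero (P.complex.X i)

/-- The terms of the resolution are free, the `i`-th one of finite rank `rk i`. -/
def IsFreeOfRanks (P : ProjectiveResolution N) (rk : ℕ → ℕ) : Prop :=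
  ∀ i, Nonempty (P.complex.X i ≃ₗ[R] (Fin (rk i) → R))

/-- A complex is `2`-periodic in degrees `≥ m` if, up to isomorphism, its part in degrees `≥ m`
is unchanged by a shift of degree by `2`. -/
def IsTwoPeriodicFrom (C : ChainComplex (ModuleCat.{u} R) ℕ) (m : ℕ) : Prop :=
  ∃ e : ∀ j, m ≤ j → (C.X j ≅ C.X (j + 2)),
    ∀ (j : ℕ) (hj : m ≤ j),
      C.d (j + 1) j ≫ (e j hj).hom =
        (e (j + 1) (Nat.le_succ_of_le hj)).hom ≫ C.d (j + 1 + 2) (j + 2)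

/-- Modules of type `FP_∞`. -/
def TypeFPInfty (N : ModuleCat.{u} R) : Prop :=
  ∃ P : ProjectiveResolution N, IsFiniteType P

end Resolutions

section Groups

/-- The trivial `ℤ[G]`-module `ℤ` (lifted to the universe of `G`). -/
noncomputable abbrev trivialModule (G : Type u) [Group G] : ModuleCat.{u} (MonoidAlgebra ℤ G) :=
  ModuleCat.of (MonoidAlgebra ℤ G) (Representation.trivial ℤ G (ULift.{u} ℤ)).asModule

/-- The cohomological dimension of `G`: the projective dimension of `ℤ` over `ℤ[G]`. -/
noncomputable def cohomologicalDimension (G : Type u) [Group G] : WithBot ℕ∞ :=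
  projectiveDimension (trivialModule G)

/-- Groups of type `FP`. -/
def TypeFP (G : Type u) [Group G] : Prop :=
  ∃ P : ProjectiveResolution (trivialModule G), IsFiniteType P ∧ ∃ n, LengthLE P n

/-- Groups of type `FL`. -/
def TypeFL (G : Type u) [Group G] : Prop :=
  ∃ (F : ProjectiveResolution (trivialModule G)) (rk : ℕ → ℕ),
    IsFreeOfRanks F rk ∧ ∃ n, LengthLE F n

/-- A group is torsion-free if only its identity element has finite order. (`IsMulTorsionFree`
asks for unique roots, which is stronger for non-commutative groups.) -/
def IsTorsionFreeGroup (G : Type u) [Group G] : Prop :=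
  ∀ g : G, IsOfFinOrder g → g = 1

/-- Groups of type `VFP`: there are torsion-free subgroups of finite index, and all of these
are of type `FP`. -/
def TypeVFP (G : Type u) [Group G] : Prop :=
  (∃ H : Subgroup G, H.FiniteIndex ∧ IsTorsionFreeGroup H) ∧
    ∀ H : Subgroup G, H.FiniteIndex → IsTorsionFreeGroup H → TypeFP H

/-- The rank of a `ℤ[G]`-module `P`: the rank over `ℤ` of the abelian group `ℤ ⊗_{ℤ[G]} P`, that
is, of the quotient of `P` by the subgroup generated by all `g p - p`. -/
noncomputable def groupRingRank {G : Type u} [Group G] (P : ModuleCat.{u} (MonoidAlgebra ℤ G)) :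
    ℕ :=
  Module.finrank ℤ
    (P ⧸ Submodule.span ℤ {x : P | ∃ (g : G) (p : P), x = MonoidAlgebra.of ℤ G g • p - p})

/-- The alternating sum of the ranks of the terms of a resolution of `ℤ` over `ℤ[G]`. On
resolutions of finite type and finite length (the only ones it is used for) its value is the Euler
characteristic of `G`. -/
noncomputable def eulerSum {G : Type u} [Group G] (P : ProjectiveResolution (trivialModule G)) :
    ℤ :=
  ∑ᶠ i : ℕ, (-1 : ℤ) ^ i * (groupRingRank (P.complex.X i) : ℤ)

/-- The Euler characteristic of `G` (a group of type `FP`) is the integer `χ`. -/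
def HasEulerCharacteristic (G : Type u) [Group G] (χ : ℤ) : Prop :=
  ∀ P : ProjectiveResolution (trivialModule G),
    IsFiniteType P → (∃ n, LengthLE P n) → eulerSum P = χ

/-- A subgroup generated by a central element is normal. -/
instance zpowersNormal {G : Type u} [Group G] (c : Subgroup.center G) :
    (Subgroup.zpowers (c : G)).Normal := by
  refine ⟨fun x hx g => ?_⟩
  obtain ⟨k, rfl⟩ := Subgroup.mem_zpowers_iff.mp hx
  have h : g * (c : G) ^ k = (c : G) ^ k * g :=
    Subgroup.mem_center_iff.mp (zpow_mem c.2 k) g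
  rw [h, mul_inv_cancel_right]
  exact hx

/-- The quotient `Γ = G / ⟨c⟩` by the subgroup generated by a central element. -/
abbrev CQuot (G : Type u) [Group G] (c : Subgroup.center G) : Type u :=
  G ⧸ Subgroup.zpowers (c : G)

/-- Restriction of scalars from `ℤ[Γ]` to `ℤ[G]` along the projection `G → Γ = G / ⟨c⟩`. -/
noncomputable def restrict {G : Type u} [Group G] (c : Subgroup.center G)
    (N : ModuleCat.{u} (MonoidAlgebra ℤ (CQuot G c))) : ModuleCat.{u} (MonoidAlgebra ℤ G) :=
  (ModuleCat.restrictScalars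
    (MonoidAlgebra.mapDomainRingHom ℤ (QuotientGroup.mk' (Subgroup.zpowers (c : G))))).obj N

end Groups

end CentralQuotient

/-! Put `x = c - 1`. If `c` had finite order `m`, the Tate cohomology of `⟨c⟩` would vanish on every
`ℤG`-module with a finite resolution by finitely generated projectives, whereas for the trivial
module `ℤ` it is `ℤ/m` in degree `0`. So a nontrivial central `c` has infinite order (`FinRes.tate`,
`not_isOfFinOrder`), `x` is a central nonzerodivisor and `ℤΓ = ℤG/(x)`. Periodicity then comes from
matrix factorizations of `x`, as over a hypersurface ring in commutative algebra.

The core is `FinRes.exists_syzygy` and `FinRes.exists_periodic`. Let `N` be killed by `x`, with a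
finite projective resolution `P`. The kernel of `P₀/xP₀ → N` is again killed by `x`, and `⋯ → P₃ →
P₂ ⊕ P₀ → P₁` resolves it in one step fewer. Iteration ends with some `0 → Q → P → K → 0` and `xK =
0`, where multiplication by `x` factors as `P → Q → P` and as `Q → P → Q`; modulo `x` these two maps
form the periodic tail. Up to order, `P` and `Q` have collected the terms of even and of odd degree.
In the free case the coefficient at `1` gives a trace; comparing the traces of the two composites
gives `-rank P = -rank Q` (`finFree_rank_eq`). Hence the even and odd ranks agree and `χ(G) = 0`.

The finite resolutions come from three sources. Tensoring a resolution of `ℤ` with a `ℤ`-projective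
module, with diagonal action, bounds the projective dimension of every `ℤG`-module
(`hasProjectiveDimensionLT_of_finRes`). Since `ℤΓ` is `ℤG` modulo a nonzerodivisor, type `FP_∞`
passes from `ℤΓ` to `ℤG` (`IsFP.restrictScalars`). Projective modules with finite free resolutions
are stably free, so a free resolution of `ℤ` can be cut down to length `cd(G)`
(`FinRes.exists_length_eq`). Schanuel's lemma makes the Euler characteristic independent of the
resolution (`FinRes.euler_eq`). -/

namespace CentralQuotient

open Function

/-! ### Finite resolutions with a list of ranks -/

section FiniteResolutions

variable {A : Type u} [Ring A]

/-- `FinRes Φ [k₀, …, kₙ] N` says that `N` has a resolution `0 → Pₙ → ⋯ → P₀ → N → 0` in which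
`Pᵢ` is a member of the class `Φ kᵢ` (the modules "of rank `kᵢ`"). -/
inductive FinRes (Φ : ℕ → ModuleCat.{u} A → Prop) : List ℕ → ModuleCat.{u} A → Prop
  | nil {N : ModuleCat.{u} A} : Subsingleton N → FinRes Φ [] N
  | cons {k : ℕ} {l : List ℕ} {K P N : ModuleCat.{u} A} (i : K →ₗ[A] P) (f : P →ₗ[A] N) :
      Injective i → Exact i f → Surjective f → Φ k P → FinRes Φ l K → FinRes Φ (k :: l) N

/-- A class of finitely generated projective modules with a rank that is additive on products. -/
structure IsRankedClass (Φ : ℕ → ModuleCat.{u} A → Prop) : Prop where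
  projective : ∀ {k P}, Φ k P → Module.Projective A P
  finite : ∀ {k P}, Φ k P → Module.Finite A P
  prod : ∀ {k l} {P Q : ModuleCat.{u} A}, Φ k P → Φ l Q → Φ (k + l) (ModuleCat.of A (P × Q))
  congr : ∀ {k} {P Q : ModuleCat.{u} A}, (P ≃ₗ[A] Q) → Φ k P → Φ k Q
  zero : Φ 0 (ModuleCat.of A PUnit.{u + 1})

/-- Adds `a` to the first entry of a list, the empty list counting as `[0]`. -/
def addHead (a : ℕ) : List ℕ → List ℕ
  | [] => [a]
  | b :: l => (b + a) :: l

/-- The sum of the entries in even position. -/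
def evenSum : List ℕ → ℕ
  | [] => 0
  | [a] => a
  | a :: _ :: l => a + evenSum l

/-- The sum of the entries in odd position. -/
def oddSum (l : List ℕ) : ℕ := evenSum l.tail

lemma evenSum_cons (a : ℕ) (l : List ℕ) : evenSum (a :: l) = a + oddSum l := by
  cases l <;> simp [evenSum, oddSum]

lemma oddSum_cons (a : ℕ) (l : List ℕ) : oddSum (a :: l) = evenSum l := rfl

lemma evenSum_addHead (a : ℕ) (l : List ℕ) : evenSum (addHead a l) = a + evenSum l := by
  cases l with
  | nil => rfl
  | cons b l => simp only [addHead, evenSum_cons]; ring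

lemma oddSum_addHead (a : ℕ) (l : List ℕ) : oddSum (addHead a l) = oddSum l := by
  cases l <;> rfl

variable {Φ : ℕ → ModuleCat.{u} A → Prop}

lemma exists_comp_eq_of_injective {L M N : Type*} [AddCommGroup L] [AddCommGroup M]
    [AddCommGroup N] [Module A L] [Module A M] [Module A N] (i : L →ₗ[A] M) (hi : Injective i)
    (f : N →ₗ[A] M) (hf : ∀ n, f n ∈ Set.range i) : ∃ g : N →ₗ[A] L, ∀ n, i (g n) = f n := by
  refine ⟨(LinearEquiv.ofInjective i hi).symm ∘ₗ f.codRestrict (LinearMap.range i) hf, fun n => ?_⟩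
  have := LinearEquiv.apply_symm_apply (LinearEquiv.ofInjective i hi)
    (f.codRestrict (LinearMap.range i) hf n)
  exact congrArg Subtype.val this

lemma FinRes.congr {l : List ℕ} {N N' : ModuleCat.{u} A} (h : FinRes Φ l N) (e : N ≃ₗ[A] N') :
    FinRes Φ l N' := by
  cases h with
  | nil h => exact .nil e.symm.injective.subsingleton
  | cons i f hi hif hf hP hK =>
    refine .cons i (e.toLinearMap ∘ₗ f) hi (fun y => ?_) (e.surjective.comp hf) hP hK
    simpa using hif y

lemma FinRes.of_rank {k : ℕ} {P : ModuleCat.{u} A} (h : Φ k P) : FinRes Φ [k] P :=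
  .cons (K := ModuleCat.of A PUnit.{u + 1}) 0 LinearMap.id (injective_of_subsingleton _)
    (fun y => by simp [eq_comm]) surjective_id h (.nil (inferInstanceAs (Subsingleton PUnit)))

/-- The extra summand goes into degree `0` and is mapped identically, so the first kernel and all
later terms are unchanged. -/
lemma FinRes.prod (hΦ : IsRankedClass Φ) {l : List ℕ} {N P : ModuleCat.{u} A} {a : ℕ}
    (h : FinRes Φ l N) (hP : Φ a P) : FinRes Φ (addHead a l) (ModuleCat.of A (N × P)) := by
  cases h with
  | nil h =>
    refine (FinRes.of_rank hP).congr ?_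
    exact LinearEquiv.ofBijective (LinearMap.inr A N P)
      ⟨LinearMap.inr_injective, fun y => ⟨y.2, Prod.ext (Subsingleton.elim _ _) rfl⟩⟩
  | cons i f hi hif hf hQ hK =>
    refine .cons (P := ModuleCat.of A (_ × P)) (LinearMap.inl A _ P ∘ₗ i) (f.prodMap LinearMap.id)
      (LinearMap.inl_injective.comp hi) ?_ (hf.prodMap surjective_id) (hΦ.prod hQ hP) hK
    rintro ⟨q, p⟩
    have := hif q
    simp only [Set.mem_range] at this
    simp only [LinearMap.prodMap_apply, LinearMap.id_apply, Prod.mk_eq_zero, this,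
      LinearMap.coe_comp, comp_apply, LinearMap.inl_apply, Set.mem_range, Prod.mk.injEq]
    exact ⟨fun ⟨⟨z, hz⟩, h⟩ => ⟨z, hz, h.symm⟩, fun ⟨z, hz, h⟩ => ⟨⟨z, hz⟩, h.symm⟩⟩

lemma FinRes.append_zero (hΦ : IsRankedClass Φ) {l : List ℕ} {N : ModuleCat.{u} A}
    (h : FinRes Φ l N) : FinRes Φ (l ++ [0]) N := by
  induction h with
  | nil h =>
    refine (FinRes.of_rank hΦ.zero).congr ?_
    exact LinearEquiv.ofBijective 0
      ⟨injective_of_subsingleton _, fun y => ⟨0, Subsingleton.elim _ _⟩⟩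
  | cons i f hi hif hf hP _ ih => exact .cons i f hi hif hf hP ih

lemma FinRes.mono {Ψ : ℕ → ModuleCat.{u} A → Prop} {φ : ℕ → ℕ}
    (hΦΨ : ∀ {k P}, Φ k P → Ψ (φ k) P) {l : List ℕ} {N : ModuleCat.{u} A}
    (h : FinRes Φ l N) : FinRes Ψ (l.map φ) N := by
  induction h with
  | nil h => exact .nil h
  | cons i f hi hif hf hP _ ih => exact .cons i f hi hif hf (hΦΨ hP) ih

end FiniteResolutions

/-! ### Resolutions as sequences of maps, and periodicity -/

section Sequences

variable {A : Type u} [Ring A]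

/-- A (possibly infinite) resolution of `N`, as a sequence of linear maps. -/
structure SeqRes (N : ModuleCat.{u} A) where
  /-- The terms. -/
  X : ℕ → ModuleCat.{u} A
  /-- The differentials. -/
  d : ∀ n, X (n + 1) →ₗ[A] X n
  /-- The augmentation. -/
  ε : X 0 →ₗ[A] N
  surjective : Surjective ε
  exact_zero : Exact (d 0) ε
  exact : ∀ n, Exact (d (n + 1)) (d n)

namespace SeqRes

/-- The resolution `⋯ → X₁ → X₀ → P → N` obtained from a resolution of the kernel of `P → N`. -/
def cons {K P N : ModuleCat.{u} A} (i : K →ₗ[A] P) (f : P →ₗ[A] N) (hi : Injective i)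
    (hif : Exact i f) (hf : Surjective f) (S : SeqRes K) : SeqRes N where
  X := fun | 0 => P | n + 1 => S.X n
  d := fun | 0 => i ∘ₗ S.ε | n + 1 => S.d n
  ε := f
  surjective := hf
  exact_zero := fun y => by
    rw [hif y]
    simp only [Set.mem_range, LinearMap.coe_comp, comp_apply]
    exact ⟨fun ⟨z, hz⟩ => ⟨_, (congrArg i (S.surjective z).choose_spec).trans hz⟩,
      fun ⟨z, hz⟩ => ⟨_, hz⟩⟩
  exact := fun
    | 0 => fun y => by
      rw [← S.exact_zero y]
      exact map_eq_zero_iff i hi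
    | n + 1 => S.exact n

/-- The resolution of the kernel of the augmentation. -/
def tail {N : ModuleCat.{u} A} (S : SeqRes N) :
    SeqRes (ModuleCat.of A (LinearMap.ker S.ε)) where
  X n := S.X (n + 1)
  d n := S.d (n + 1)
  ε := (S.d 0).codRestrict _ fun y => (S.exact_zero _).2 ⟨y, rfl⟩
  surjective := fun ⟨y, hy⟩ => by
    obtain ⟨z, hz⟩ := (S.exact_zero y).1 hy
    exact ⟨z, Subtype.ext hz⟩
  exact_zero := fun y => by
    rw [← S.exact 0 y]
    exact Subtype.ext_iff
  exact n := S.exact (n + 1)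

/-- Periodicity of period `2` in degrees `≥ m`. -/
def IsPeriodicFrom {N : ModuleCat.{u} A} (S : SeqRes N) (m : ℕ) : Prop :=
  ∃ e : ∀ j, m ≤ j → (S.X j ≃ₗ[A] S.X (j + 2)), ∀ (j : ℕ) (hj : m ≤ j) (y : S.X (j + 1)),
    e j hj (S.d j y) = S.d (j + 2) (e (j + 1) (Nat.le_succ_of_le hj) y)

lemma IsPeriodicFrom.cons {K P N : ModuleCat.{u} A} {i : K →ₗ[A] P} {f : P →ₗ[A] N}
    {hi : Injective i} {hif : Exact i f} {hf : Surjective f} {S : SeqRes K} {m : ℕ}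
    (h : S.IsPeriodicFrom m) : (cons i f hi hif hf S).IsPeriodicFrom (m + 1) := by
  obtain ⟨e, he⟩ := h
  refine ⟨fun
    | 0, hj => absurd hj (by simp)
    | j + 1, hj => e j (Nat.le_of_succ_le_succ hj), ?_⟩
  rintro (_ | j) hj y
  · simp at hj
  · exact he j (Nat.le_of_succ_le_succ hj) y

lemma IsPeriodicFrom.mono {N : ModuleCat.{u} A} {S : SeqRes N} {m m' : ℕ}
    (h : S.IsPeriodicFrom m) (hm : m ≤ m') : S.IsPeriodicFrom m' := by
  obtain ⟨e, he⟩ := h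
  exact ⟨fun j hj => e j (hm.trans hj), fun j hj y => he j (hm.trans hj) y⟩

end SeqRes

end Sequences

/-! ### Matrix factorizations and periodic resolutions modulo a central nonzerodivisor -/

section Periodicity

variable {A : Type u} [Ring A] {Φ : ℕ → ModuleCat.{u} A → Prop}

/-- Multiplication by a central element. -/
def centralMul (x : A) (hx : ∀ a, a * x = x * a) (M : Type*) [AddCommGroup M] [Module A M] :
    M →ₗ[A] M where
  toFun m := x • m
  map_add' := smul_add x
  map_smul' a m := by simp [← mul_smul, hx]

/-- The quotient `M / xM`. -/
abbrev reduction (x : A) (hx : ∀ a, a * x = x * a) (M : Type*) [AddCommGroup M] [Module A M] :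
    Type _ := M ⧸ LinearMap.range (centralMul x hx M)

lemma smul_reduction (x : A) (hx : ∀ a, a * x = x * a) (M : Type*) [AddCommGroup M] [Module A M]
    (m : reduction x hx M) : x • m = 0 := by
  obtain ⟨m, rfl⟩ := Submodule.mkQ_surjective _ m
  rw [← map_smul]
  exact (Submodule.Quotient.mk_eq_zero _).2 ⟨m, rfl⟩

lemma mkQ_reduction_eq_zero {x : A} {hx : ∀ a, a * x = x * a} {M : Type*} [AddCommGroup M]
    [Module A M] {m : M} :
    (Submodule.mkQ _ m : reduction x hx M) = 0 ↔ ∃ m', x • m' = m := by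
  rw [Submodule.mkQ_apply, Submodule.Quotient.mk_eq_zero]
  rfl

/-- The map induced on the quotients by the multiples of `x`. -/
def mapReduction (x : A) (hx : ∀ a, a * x = x * a) {M N : Type*} [AddCommGroup M] [Module A M]
    [AddCommGroup N] [Module A N] (f : M →ₗ[A] N) : reduction x hx M →ₗ[A] reduction x hx N :=
  Submodule.mapQ _ _ f (by rintro _ ⟨m, rfl⟩; exact ⟨f m, (map_smul f x m).symm⟩)

/-- A projective module embeds in a free one, where multiplication by `x` is injective in each
coordinate. -/
lemma smul_eq_zero_of_projective {x : A} (hx0 : ∀ a, x * a = 0 → a = 0) {P : Type*}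
    [AddCommGroup P] [Module A P] [Module.Projective A P] {p : P} (h : x • p = 0) : p = 0 := by
  obtain ⟨s, hs⟩ := Module.projective_def'.1 ‹Module.Projective A P›
  have : s p = 0 := by
    ext q
    exact hx0 _ (by rw [← smul_eq_mul, ← Finsupp.smul_apply, ← map_smul, h]; simp)
  have h2 := LinearMap.congr_fun hs p
  simpa [this] using h2.symm

/-- A resolution of length one of a module killed by `x` is a matrix factorization of `x`. -/
lemma exists_matrixFactorization {x : A} {hx : ∀ a, a * x = x * a}
    {P Q N : ModuleCat.{u} A}
    (i : Q →ₗ[A] P) (f : P →ₗ[A] N) (hi : Injective i) (hif : Exact i f) (hN : ∀ n : N, x • n = 0) :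
    ∃ s : P →ₗ[A] Q, (∀ p, i (s p) = x • p) ∧ ∀ q, s (i q) = x • q := by
  obtain ⟨s, hs⟩ := exists_comp_eq_of_injective i hi (centralMul x hx P) fun p =>
    (hif _).1 (by simpa [centralMul] using hN (f p))
  exact ⟨s, hs, fun q => hi ((hs _).trans (map_smul i x q).symm)⟩

/-- With `Z = ker (P → N)`, the kernel of `P/xP → N` is `Z/xP`. The cover `P₁ → Z → Z/xP` has as its
kernel the old kernel `Z₂` together with a lift of `xP ≅ P` to `P₁`. This moves the rank `a` two
degrees up, hence `addHead`. -/
lemma FinRes.exists_syzygy (hΦ : IsRankedClass Φ) {x : A} (hx : ∀ a, a * x = x * a)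
    (hx0 : ∀ a, x * a = 0 → a = 0) {a b : ℕ} {l : List ℕ} {N : ModuleCat.{u} A}
    (h : FinRes Φ (a :: b :: l) N) (hN : ∀ n : N, x • n = 0) :
    ∃ (P K : ModuleCat.{u} A) (i : K →ₗ[A] reduction x hx P) (f : reduction x hx P →ₗ[A] N),
      Injective i ∧ Exact i f ∧ Surjective f ∧ Φ a P ∧ (∀ k : K, x • k = 0) ∧
        FinRes Φ (b :: addHead a l) K := by
  cases h with
  | @cons _ _ Z P _ i₀ f₀ hi₀ hif₀ hf₀ hP hZ =>
  cases hZ with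
  | @cons _ _ Z₂ P₁ _ i₁ g hi₁ hig hg hP₁ hZ₂ =>
  have := hΦ.projective hP
  obtain ⟨j, hj⟩ := exists_comp_eq_of_injective i₀ hi₀ (centralMul x hx P) fun p =>
    (hif₀ _).1 (by simpa [centralMul] using hN (f₀ p))
  replace hj : ∀ p, i₀ (j p) = x • p := hj
  -- `j` is multiplication by `x` viewed as a map `P → Z`; its lift `s` to `P₁` embeds the second
  -- summand of the new kernel.
  obtain ⟨s, hs⟩ := Module.projective_lifting_property g j hg
  replace hs : ∀ p, g (s p) = j p := LinearMap.congr_fun hs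
  let f : reduction x hx P →ₗ[A] N := Submodule.liftQ _ f₀ (by
    rintro _ ⟨p, rfl⟩
    simpa [centralMul] using hN (f₀ p))
  have hf : ∀ p, f (Submodule.mkQ _ p) = f₀ p := fun p => rfl
  let q : Z →ₗ[A] LinearMap.ker f := (Submodule.mkQ _ ∘ₗ i₀).codRestrict _ fun z => by
    simpa [f] using (hif₀ _).2 ⟨z, rfl⟩
  have hq : ∀ z, (q z : reduction x hx P) = Submodule.mkQ _ (i₀ z) := fun z => rfl
  have hq0 : ∀ z, q z = 0 ↔ ∃ p, j p = z := fun z => by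
    rw [Subtype.ext_iff, hq, ZeroMemClass.coe_zero, mkQ_reduction_eq_zero]
    exact exists_congr fun p => by rw [← hj, hi₀.eq_iff]
  have hqs : Surjective q := by
    rintro ⟨y, hy⟩
    obtain ⟨p, rfl⟩ := Submodule.mkQ_surjective _ y
    obtain ⟨z, rfl⟩ := (hif₀ p).1 hy
    exact ⟨z, rfl⟩
  refine ⟨P, ModuleCat.of A (LinearMap.ker f), Submodule.subtype _, f, Subtype.val_injective,
    fun y => ⟨fun h => ⟨⟨y, h⟩, rfl⟩, by rintro ⟨y, rfl⟩; exact y.2⟩, ?_, hP,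
    fun k => Subtype.ext (smul_reduction x hx P k), ?_⟩
  · intro n
    obtain ⟨p, rfl⟩ := hf₀ n
    exact ⟨Submodule.mkQ _ p, rfl⟩
  refine FinRes.cons (K := ModuleCat.of A (Z₂ × P)) (i₁.coprod s) (q ∘ₗ g) ?_ ?_ (hqs.comp hg) hP₁
    (hZ₂.prod hΦ hP)
  · refine (injective_iff_map_eq_zero _).2 ?_
    rintro ⟨z, p⟩ h
    replace h : i₁ z + s p = 0 := h
    have h1 : j p = 0 := by
      have := congrArg g h
      rwa [map_add, (hig _).2 ⟨z, rfl⟩, zero_add, map_zero, hs] at this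
    have h2 : p = 0 := smul_eq_zero_of_projective hx0 (by rw [← hj, h1, map_zero])
    subst h2
    rw [map_zero, add_zero] at h
    rw [(map_eq_zero_iff i₁ hi₁).1 h]
    rfl
  · intro y
    rw [LinearMap.comp_apply, hq0]
    constructor
    · rintro ⟨p, hp⟩
      obtain ⟨z, hz⟩ := (hig (y - s p)).1 (by rw [map_sub, hs, hp, sub_self])
      exact ⟨(z, p), by simp [hz]⟩
    · rintro ⟨⟨z, p⟩, rfl⟩
      exact ⟨p, by simp [hs, (hig _).2 ⟨z, rfl⟩]⟩

/-- The sequence `P, Q, P, Q, …`. -/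
def altX (P Q : ModuleCat.{u} A) : ℕ → ModuleCat.{u} A
  | 0 => P
  | n + 1 => altX Q P n

/-- The sequence of maps `f, g, f, g, …`. -/
def altD {P Q : ModuleCat.{u} A} (f : Q →ₗ[A] P) (g : P →ₗ[A] Q) :
    ∀ n, altX P Q (n + 1) →ₗ[A] altX P Q n
  | 0 => f
  | n + 1 => altD g f n

lemma exact_altD {P Q : ModuleCat.{u} A} (f : Q →ₗ[A] P) (g : P →ₗ[A] Q) (hfg : Exact f g)
    (hgf : Exact g f) : ∀ n, Exact (altD f g (n + 1)) (altD f g n)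
  | 0 => hgf
  | n + 1 => exact_altD g f hgf hfg n

lemma altX_of_and {p : ModuleCat.{u} A → Prop} {P Q : ModuleCat.{u} A} (hP : p P) (hQ : p Q) :
    ∀ n, p (altX P Q n)
  | 0 => hP
  | n + 1 => altX_of_and hQ hP n

/-- The `2`-periodic resolution given by an exact sequence `P → Q → P → N → 0`. -/
def SeqRes.alternating {P Q N : ModuleCat.{u} A} (f : Q →ₗ[A] P) (g : P →ₗ[A] Q) (π : P →ₗ[A] N)
    (hfg : Exact f g) (hgf : Exact g f) (hfπ : Exact f π) (hπ : Surjective π) : SeqRes N where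
  X := altX P Q
  d := altD f g
  ε := π
  surjective := hπ
  exact_zero := hfπ
  exact := exact_altD f g hfg hgf

lemma SeqRes.isPeriodicFrom_alternating {P Q N : ModuleCat.{u} A} {f : Q →ₗ[A] P}
    {g : P →ₗ[A] Q} {π : P →ₗ[A] N} {hfg : Exact f g} {hgf : Exact g f} {hfπ : Exact f π}
    {hπ : Surjective π} : (alternating f g π hfg hgf hfπ hπ).IsPeriodicFrom 0 :=
  ⟨fun j _ => LinearEquiv.refl A (altX P Q j), fun _ _ _ => rfl⟩

/-- If `x` is a central nonzerodivisor, every module `N` with `xN = 0` that has a finite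
resolution has a resolution that is eventually `2`-periodic, whose terms are reductions modulo `x`
of sums of terms of the finite resolution. -/
theorem FinRes.exists_periodic (hΦ : IsRankedClass Φ) {x : A} (hx : ∀ a, a * x = x * a)
    (hx0 : ∀ a, x * a = 0 → a = 0)
    (hrank : ∀ {k l : ℕ} {P Q : ModuleCat.{u} A}, Φ k P → Φ l Q →
      ∀ (f : P →ₗ[A] Q) (g : Q →ₗ[A] P), (∀ p, g (f p) = x • p) → (∀ q, f (g q) = x • q) → k = l)
    {l : List ℕ} {a b : ℕ} {N : ModuleCat.{u} A} (h : FinRes Φ (a :: b :: l) N)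
    (hN : ∀ n : N, x • n = 0) :
    evenSum (a :: b :: l) = oddSum (a :: b :: l) ∧
    ∃ (S : SeqRes N) (rk : ℕ → ℕ), S.IsPeriodicFrom l.length ∧
      (∀ j, ∃ P : ModuleCat.{u} A, Φ (rk j) P ∧ Nonempty (S.X j ≃ₗ[A] reduction x hx P)) ∧
      ∀ j, l.length ≤ j → rk j = evenSum (a :: b :: l) := by
  induction l generalizing a b N with
  | nil =>
    cases h with
    | @cons _ _ Z P _ i f hi hif hf hP hZ =>
    cases hZ with
    | @cons _ _ Z₂ Q _ i₁ g hi₁ hig hg hQ hZ₂ =>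
    cases hZ₂ with
    | nil hZ₂ =>
    have hgi : Injective g := (injective_iff_map_eq_zero g).2 fun y hy => by
      obtain ⟨z, rfl⟩ := (hig y).1 hy
      rw [Subsingleton.elim z 0, map_zero]
    have hu : Injective (i ∘ₗ g) := hi.comp hgi
    have huf : Exact (i ∘ₗ g) f := fun y => by
      rw [hif y]
      exact ⟨fun ⟨z, hz⟩ => ⟨_, (congrArg i (hg z).choose_spec).trans hz⟩,
        fun ⟨z, hz⟩ => ⟨_, hz⟩⟩
    generalize i ∘ₗ g = v at hu huf
    obtain ⟨s, hvs, hsv⟩ := exists_matrixFactorization (hx := hx) v f hu huf hN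
    obtain rfl : a = b := hrank hP hQ s v hvs hsv
    have := hΦ.projective hP
    have hs : Injective s := (injective_iff_map_eq_zero s).2 fun p hp =>
      smul_eq_zero_of_projective hx0 (by rw [← hvs, hp, map_zero])
    -- If `v q = x p`, then `v q = v (s p)` and so `q = s p`. The hypotheses are symmetric in the
    -- two factors, so this gives exactness at both places of the period.
    have key : ∀ {P Q : ModuleCat.{u} A} (v : Q →ₗ[A] P) (s : P →ₗ[A] Q), Injective v →
        (∀ p, v (s p) = x • p) → (∀ q, s (v q) = x • q) →
        Exact (mapReduction x hx s) (mapReduction x hx v) := by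
      intro P Q v s hv hvs hsv y
      obtain ⟨q, rfl⟩ := Submodule.mkQ_surjective _ y
      constructor
      · intro h
        obtain ⟨p, hp⟩ := mkQ_reduction_eq_zero.1 (show Submodule.mkQ _ (v q) = 0 from h)
        refine ⟨Submodule.mkQ _ p, ?_⟩
        rw [← hvs, hv.eq_iff] at hp
        rw [← hp]
        rfl
      · rintro ⟨z, hz⟩
        obtain ⟨p, rfl⟩ := Submodule.mkQ_surjective _ z
        rw [← hz]
        exact mkQ_reduction_eq_zero.2 ⟨p, (hvs p).symm⟩
    let π : reduction x hx P →ₗ[A] N := Submodule.liftQ _ f (by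
      rintro _ ⟨p, rfl⟩
      simpa [centralMul] using hN (f p))
    refine ⟨rfl, .alternating (P := ModuleCat.of A (reduction x hx P))
      (Q := ModuleCat.of A (reduction x hx Q)) (mapReduction x hx v) (mapReduction x hx s) π
      (key _ _ hs hsv hvs) (key _ _ hu hvs hsv) ?_ ?_, fun _ => a,
      SeqRes.isPeriodicFrom_alternating, ?_, fun _ _ => rfl⟩
    · intro y
      obtain ⟨p, rfl⟩ := Submodule.mkQ_surjective _ y
      refine (huf p).trans ⟨?_, ?_⟩
      · rintro ⟨q, rfl⟩
        exact ⟨Submodule.mkQ _ q, rfl⟩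
      · rintro ⟨z, hz⟩
        obtain ⟨q, rfl⟩ := Submodule.mkQ_surjective _ z
        refine (huf p).1 ?_
        have : f (v q) = f p := congrArg π hz
        rw [← this]
        exact (huf _).2 ⟨q, rfl⟩
    · intro n
      obtain ⟨p, rfl⟩ := hf n
      exact ⟨Submodule.mkQ _ p, rfl⟩
    · exact altX_of_and (p := fun X => ∃ P : ModuleCat.{u} A, Φ a P ∧
        Nonempty (X ≃ₗ[A] reduction x hx P)) ⟨P, hP, ⟨.refl _ _⟩⟩ ⟨Q, hQ, ⟨.refl _ _⟩⟩
  | cons c l ih =>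
    obtain ⟨P, K, i, f, hi, hif, hf, hP, hK, hres⟩ := h.exists_syzygy hΦ hx hx0 hN
    obtain ⟨heo, S, rk, hS, hterms, hrk⟩ := ih hres hK
    -- Passing to the syzygy interchanges the even and the odd sum, so their equality propagates
    -- back and the rank of the tail stays the same.
    have he : evenSum (b :: addHead a (c :: l)) = oddSum (a :: b :: c :: l) := by
      simp only [evenSum_cons, oddSum_cons, oddSum_addHead]
    have ho : oddSum (b :: addHead a (c :: l)) = evenSum (a :: b :: c :: l) := by
      rw [oddSum_cons, evenSum_addHead]
      rfl
    change evenSum (b :: addHead a (c :: l)) = oddSum (b :: addHead a (c :: l)) at heo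
    have heo' : evenSum (a :: b :: c :: l) = oddSum (a :: b :: c :: l) := by
      rw [← he, ← ho, heo]
    refine ⟨heo', .cons (P := ModuleCat.of A (reduction x hx P)) i f hi hif hf S,
      fun | 0 => a | n + 1 => rk n, hS.cons, ?_, ?_⟩
    · rintro (_ | j)
      · exact ⟨P, hP, ⟨.refl _ _⟩⟩
      · exact hterms j
    · rintro (_ | j) hj
      · simp at hj
      · exact (hrk j (by simpa using hj)).trans (he.trans heo'.symm)

end Periodicity

/-! ### Passage between sequences, finite resolutions and `ProjectiveResolution` -/

section Conversion

variable {A : Type u} [Ring A]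

namespace SeqRes

/-- The chain complex of the terms of a resolution. -/
noncomputable def complex {N : ModuleCat.{u} A} (S : SeqRes N) : ChainComplex (ModuleCat.{u} A) ℕ :=
  ChainComplex.of S.X (fun n => ModuleCat.ofHom (S.d n)) fun n => by
    ext y
    exact (S.exact n _).2 ⟨y, rfl⟩

lemma complex_d {N : ModuleCat.{u} A} (S : SeqRes N) (n : ℕ) :
    S.complex.d (n + 1) n = ModuleCat.ofHom (S.d n) :=
  ChainComplex.of_d S.X (fun n => ModuleCat.ofHom (S.d n)) n

/-- In degree `0` a quasi-isomorphism to a single module amounts to exactness of `C₁ → C₀ → N → 0`;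
in positive degrees it amounts to exactness of `C`. -/
lemma quasiIso_of_exact {N : ModuleCat.{u} A} (C : ChainComplex (ModuleCat.{u} A) ℕ)
    (f : C.X 0 ⟶ N) (w : C.d 1 0 ≫ f = 0) (h0 : (ShortComplex.mk _ _ w).Exact) (hf : Epi f)
    (h : ∀ n, C.ExactAt (n + 1)) :
    QuasiIso ((ChainComplex.toSingle₀Equiv C N).symm ⟨f, w⟩) := ⟨fun n => by
  cases n
  · rw [ChainComplex.quasiIsoAt₀_iff, ShortComplex.quasiIso_iff_of_zeros']
    · refine (ShortComplex.exact_and_epi_g_iff_of_iso ?_).2 ⟨h0, hf⟩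
      exact ShortComplex.isoMk (Iso.refl _) (Iso.refl _) (Iso.refl _)
        ((Category.id_comp _).trans (Category.comp_id _).symm)
        ((Category.id_comp _).trans (Category.comp_id _).symm)
    all_goals first | rfl | exact C.shape _ _ (by simp)
  · rw [quasiIsoAt_iff_exactAt']
    · apply h
    · apply ChainComplex.exactAt_succ_single_obj⟩

/-- A resolution by projective modules as a projective resolution. -/
noncomputable def toProjectiveResolution {N : ModuleCat.{u} A} (S : SeqRes N)
    (hS : ∀ j, Module.Projective A (S.X j)) : ProjectiveResolution N where
  complex := S.complex
  projective n := (IsProjective.iff_projective (S.X n)).1 (hS n)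
  π := (ChainComplex.toSingle₀Equiv S.complex N).symm ⟨ModuleCat.ofHom S.ε, by
    rw [complex_d]
    ext y
    exact (S.exact_zero _).2 ⟨y, rfl⟩⟩
  quasiIso := by
    refine quasiIso_of_exact _ _ _ ?_ ((ModuleCat.epi_iff_surjective _).2 S.surjective) fun n => ?_
    · rw [ShortComplex.ShortExact.moduleCat_exact_iff_function_exact]
      change Exact (S.complex.d 1 0).hom S.ε
      rw [show S.complex.d 1 0 = ModuleCat.ofHom (S.d 0) from S.complex_d 0]
      exact S.exact_zero
    · rw [HomologicalComplex.exactAt_iff' _ (n + 1 + 1) (n + 1) n (by simp) (by simp),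
        ShortComplex.ShortExact.moduleCat_exact_iff_function_exact]
      change Exact (S.complex.d (n + 1 + 1) (n + 1)).hom (S.complex.d (n + 1) n).hom
      rw [complex_d, complex_d]
      exact S.exact n

lemma IsPeriodicFrom.isTwoPeriodicFrom {N : ModuleCat.{u} A} {S : SeqRes N} {m : ℕ}
    (h : S.IsPeriodicFrom m) : IsTwoPeriodicFrom S.complex m := by
  obtain ⟨e, he⟩ := h
  refine ⟨fun j hj => (e j hj).toModuleIso, fun j hj => ?_⟩
  rw [complex_d, complex_d]
  ext y
  exact he j hj y

/-- The sequence underlying a projective resolution. -/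
noncomputable def ofProjectiveResolution {N : ModuleCat.{u} A} (P : ProjectiveResolution N) :
    SeqRes N where
  X := P.complex.X
  d n := (P.complex.d (n + 1) n).hom
  ε := (P.π.f 0).hom
  surjective := (ModuleCat.epi_iff_surjective (P.π.f 0)).1 inferInstance
  exact_zero := (ShortComplex.ShortExact.moduleCat_exact_iff_function_exact _).1 P.exact₀
  exact n := (ShortComplex.ShortExact.moduleCat_exact_iff_function_exact _).1 (P.exact_succ n)

end SeqRes

lemma FinRes.of_seqRes {Φ : ℕ → ModuleCat.{u} A → Prop} {N : ModuleCat.{u} A} (S : SeqRes N)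
    (rk : ℕ → ℕ) (hS : ∀ j, Φ (rk j) (S.X j)) (n : ℕ) (hn : ∀ j, n < j → Subsingleton (S.X j)) :
    FinRes Φ ((List.range (n + 1)).map rk) N := by
  induction n generalizing N rk with
  | zero =>
    refine .cons (K := ModuleCat.of A (LinearMap.ker S.ε)) (Submodule.subtype _) S.ε
      Subtype.val_injective (LinearMap.exact_subtype_ker_map _) S.surjective (hS 0) (.nil ?_)
    have : Subsingleton (S.tail.X 0) := hn 1 one_pos
    exact S.tail.surjective.subsingleton
  | succ n ih =>
    rw [List.range_succ_eq_map, List.map_cons, List.map_map]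
    exact .cons (K := ModuleCat.of A (LinearMap.ker S.ε)) (Submodule.subtype _) S.ε
      Subtype.val_injective (LinearMap.exact_subtype_ker_map _) S.surjective (hS 0)
      (ih S.tail (rk ∘ Nat.succ) (fun j => hS (j + 1)) fun j hj => hn (j + 1) (by omega))

lemma FinRes.exists_seqRes {Φ : ℕ → ModuleCat.{u} A → Prop} (hΦ : IsRankedClass Φ) {l : List ℕ}
    {N : ModuleCat.{u} A} (h : FinRes Φ l N) :
    ∃ S : SeqRes N, (∀ j, Φ (l.getD j 0) (S.X j)) ∧ ∀ j, l.length ≤ j → Subsingleton (S.X j) := by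
  induction h with
  | nil h =>
    refine ⟨⟨fun _ => ModuleCat.of A PUnit.{u + 1}, fun _ => 0, 0, fun y =>
      ⟨0, Subsingleton.elim _ _⟩, fun y => ?_, fun n y => ?_⟩, fun j => ?_, fun j _ => ?_⟩
    · exact ⟨fun _ => ⟨0, Subsingleton.elim (α := PUnit) _ _⟩, fun _ => Subsingleton.elim _ _⟩
    · exact ⟨fun _ => ⟨0, Subsingleton.elim (α := PUnit) _ _⟩,
        fun _ => Subsingleton.elim (α := PUnit) _ _⟩
    · simpa using hΦ.zero
    · exact inferInstanceAs (Subsingleton PUnit)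
  | cons i f hi hif hf hP hK ih =>
    obtain ⟨S, hS, hS'⟩ := ih
    refine ⟨.cons i f hi hif hf S, ?_, ?_⟩
    · rintro (_ | j)
      · exact hP
      · exact hS j
    · rintro (_ | j) hj
      · simp at hj
      · exact hS' j (by simpa using hj)

end Conversion

/-! ### Projective dimension and finiteness conditions -/

section ProjectiveDimension

variable {A : Type u} [Ring A]

lemma hasProjectiveDimensionLT_of_subsingleton {N : ModuleCat.{u} A} [Subsingleton N] (n : ℕ) :
    HasProjectiveDimensionLT N n :=
  have := (ModuleCat.isZero_of_subsingleton N).hasProjectiveDimensionLT_zero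
  hasProjectiveDimensionLT_of_ge N 0 n n.zero_le

lemma hasProjectiveDimensionLT_succ_of_exact {K P N : ModuleCat.{u} A} {n : ℕ} (i : K →ₗ[A] P)
    (f : P →ₗ[A] N) (hi : Injective i) (hif : Exact i f) (hf : Surjective f)
    (hK : HasProjectiveDimensionLT K n) (hP : Module.Projective A P) :
    HasProjectiveDimensionLT N (n + 1) := by
  have hP := (IsProjective.iff_projective P).1 hP
  have := ModuleCat.shortComplex_shortExact (ShortComplex.mk (ModuleCat.ofHom i) (ModuleCat.ofHom f)
    (by ext y; exact (hif _).2 ⟨y, rfl⟩)) hif hi hf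
  exact this.hasProjectiveDimensionLT_X₃ n hK (hasProjectiveDimensionLT_of_ge P 1 _ (by simp))

/-- Dimension shifting. The bound `n + 2` on `N` keeps the conclusion at `1` or more: the kernel
over a projective `N` is projective but need not vanish. -/
lemma hasProjectiveDimensionLT_kernel {K P N : ModuleCat.{u} A} {n : ℕ} (i : K →ₗ[A] P)
    (f : P →ₗ[A] N) (hi : Injective i) (hif : Exact i f) (hf : Surjective f)
    (hN : HasProjectiveDimensionLT N (n + 2)) (hP : Module.Projective A P) :
    HasProjectiveDimensionLT K (n + 1) := by
  have hP := (IsProjective.iff_projective P).1 hP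
  have := ModuleCat.shortComplex_shortExact (ShortComplex.mk (ModuleCat.ofHom i) (ModuleCat.ofHom f)
    (by ext y; exact (hif _).2 ⟨y, rfl⟩)) hif hi hf
  exact this.hasProjectiveDimensionLT_X₁ (n + 1)
    (hasProjectiveDimensionLT_of_ge P 1 _ (by simp)) hN

lemma projective_of_hasProjectiveDimensionLT {N : ModuleCat.{u} A}
    (h : HasProjectiveDimensionLT N 1) : Module.Projective A N :=
  (IsProjective.iff_projective N).2 inferInstance

/-- The class of finitely generated projective modules, all considered to be of rank `0`. -/
def finProj (A : Type u) [Ring A] (k : ℕ) (P : ModuleCat.{u} A) : Prop :=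
  k = 0 ∧ Module.Projective A P ∧ Module.Finite A P

lemma isRankedClass_finProj : IsRankedClass (finProj A) where
  projective h := h.2.1
  finite h := h.2.2
  prod h h' := by
    obtain ⟨rfl, _, _⟩ := h
    obtain ⟨rfl, _, _⟩ := h'
    exact ⟨rfl, inferInstance, inferInstance⟩
  congr e h := by
    obtain ⟨rfl, _, _⟩ := h
    exact ⟨rfl, .of_equiv e, .equiv e⟩
  zero := ⟨rfl, inferInstance, inferInstance⟩

/-- The class of free modules of finite rank. -/
def finFree (A : Type u) [Ring A] (k : ℕ) (P : ModuleCat.{u} A) : Prop :=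
  Nonempty (P ≃ₗ[A] (Fin k → A))

lemma isRankedClass_finFree : IsRankedClass (finFree A) where
  projective := fun ⟨e⟩ => .of_equiv e.symm
  finite := fun ⟨e⟩ => .equiv e.symm
  prod := fun ⟨e⟩ ⟨e'⟩ => ⟨(e.prodCongr e').trans
    ((LinearEquiv.sumArrowLequivProdArrow _ _ A A).symm.trans
      (LinearEquiv.funCongrLeft A A finSumFinEquiv.symm))⟩
  congr e := fun ⟨e'⟩ => ⟨e.symm.trans e'⟩
  zero := ⟨LinearEquiv.ofBijective 0 ⟨injective_of_subsingleton _,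
    fun _ => ⟨0, Subsingleton.elim _ _⟩⟩⟩

/-- Modules with a resolution that is finitely generated projective in degrees `< m` and finitely
generated in degree `m`. -/
def IsFP : ℕ → ModuleCat.{u} A → Prop
  | 0, N => Module.Finite A N
  | m + 1, N => ∃ (P K : ModuleCat.{u} A) (i : K →ₗ[A] P) (f : P →ₗ[A] N), Injective i ∧
      Exact i f ∧ Surjective f ∧ Module.Projective A P ∧ Module.Finite A P ∧ IsFP m K

lemma IsFP.of_seqRes {N : ModuleCat.{u} A} (S : SeqRes N) (hS : ∀ j, Module.Projective A (S.X j))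
    (hS' : ∀ j, Module.Finite A (S.X j)) (m : ℕ) : IsFP m N := by
  induction m generalizing N with
  | zero =>
    have := hS' 0
    exact Module.Finite.of_surjective S.ε S.surjective
  | succ m ih =>
    exact ⟨_, _, Submodule.subtype _, S.ε, Subtype.val_injective,
      LinearMap.exact_subtype_ker_map _, S.surjective, hS 0, hS' 0,
      ih S.tail (fun j => hS _) fun j => hS' _⟩

/-- A lift to `L` of a cover `P → K` gives a cover `F ⊕ P → L` with the same kernel as `P → K`, so
`L` inherits the finiteness of `K`. -/
lemma IsFP.of_extension {m : ℕ} {F L K : ModuleCat.{u} A} (i : F →ₗ[A] L) (f : L →ₗ[A] K)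
    (hi : Injective i) (hif : Exact i f) (hf : Surjective f) [Module.Projective A F]
    [Module.Finite A F] (hK : IsFP m K) : IsFP m L := by
  cases m with
  | zero =>
    have : Module.Finite A K := hK
    obtain ⟨n, g, hg⟩ := Module.Finite.exists_fin' A K
    obtain ⟨t, ht⟩ := Module.projective_lifting_property f g hf
    replace ht : ∀ p, f (t p) = g p := LinearMap.congr_fun ht
    refine Module.Finite.of_surjective (i.coprod t) fun y => ?_
    obtain ⟨p, hp⟩ := hg (f y)
    obtain ⟨q, hq⟩ := (hif (y - t p)).1 (by simp [ht, hp])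
    exact ⟨(q, p), by simp [hq]⟩
  | succ m =>
    obtain ⟨P, K₂, j, g, hj, hjg, hg, hP, hP', hK₂⟩ := hK
    obtain ⟨t, ht⟩ := Module.projective_lifting_property f g hf
    replace ht : ∀ p, f (t p) = g p := LinearMap.congr_fun ht
    obtain ⟨s, hs⟩ := exists_comp_eq_of_injective i hi (t ∘ₗ j) fun k =>
      (hif _).1 (by rw [LinearMap.comp_apply, ht]; exact (hjg _).2 ⟨k, rfl⟩)
    replace hs : ∀ k, i (s k) = t (j k) := hs
    refine ⟨ModuleCat.of A (F × P), K₂, (-s).prod j, i.coprod t, fun a b h => ?_, ?_, ?_,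
      inferInstance, inferInstance, hK₂⟩
    · exact hj (Prod.ext_iff.1 h).2
    · rintro ⟨q, p⟩
      constructor
      · intro h
        replace h : i q + t p = 0 := h
        have h1 : g p = 0 := by
          have := congrArg f h
          rwa [map_add, (hif _).2 ⟨q, rfl⟩, ht, zero_add, map_zero] at this
        obtain ⟨k, rfl⟩ := (hjg _).1 h1
        refine ⟨k, Prod.ext (hi ?_) rfl⟩
        rw [← hs, ← eq_neg_iff_add_eq_zero] at h
        simp [h]
      · rintro ⟨k, hk⟩
        rw [← hk]
        simp [hs]
    · intro y
      obtain ⟨p, hp⟩ := hg (f y)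
      obtain ⟨q, hq⟩ := (hif (y - t p)).1 (by simp [ht, hp])
      exact ⟨(q, p), by simp [hq]⟩

/-- The first step of the resolution may be taken free. -/
lemma IsFP.exists_free {m : ℕ} {N : ModuleCat.{u} A} (h : IsFP (m + 1) N) :
    ∃ (k : ℕ) (K : ModuleCat.{u} A) (i : K →ₗ[A] (Fin k → A)) (f : (Fin k → A) →ₗ[A] N),
      Injective i ∧ Exact i f ∧ Surjective f ∧ IsFP m K := by
  obtain ⟨P, K, i, f, hi, hif, hf, hP, hP', hK⟩ := h
  obtain ⟨k, r, s, hr, hs, hrs⟩ := Module.Finite.exists_comp_eq_id_of_projective A P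
  replace hrs : ∀ p, r (s p) = p := LinearMap.congr_fun hrs
  let ρ : (Fin k → A) →ₗ[A] LinearMap.ker r := (LinearMap.id - s ∘ₗ r).codRestrict _ fun a => by
    simp [hrs]
  have hρ : ∀ q : LinearMap.ker r, ρ q = q := fun q => Subtype.ext (by simp [ρ])
  have : Module.Projective A (LinearMap.ker r) :=
    .of_split (Submodule.subtype _) ρ (LinearMap.ext hρ)
  have : Module.Finite A (LinearMap.ker r) :=
    .of_surjective ρ fun q => ⟨q, hρ q⟩
  refine ⟨k, ModuleCat.of A (LinearMap.ker (f ∘ₗ r)), Submodule.subtype _, f ∘ₗ r,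
    Subtype.val_injective, LinearMap.exact_subtype_ker_map _, hf.comp hr, ?_⟩
  obtain ⟨g, hg⟩ := exists_comp_eq_of_injective i hi (r ∘ₗ (LinearMap.ker (f ∘ₗ r)).subtype)
    fun y => (hif _).1 y.2
  -- The kernel of `Aᵏ → P → N` is an extension of `K` by `ker r`, which is a direct summand of
  -- `Aᵏ`.
  refine hK.of_extension (F := ModuleCat.of A (LinearMap.ker r))
    (L := ModuleCat.of A (LinearMap.ker (f ∘ₗ r))) (Submodule.inclusion fun y hy => by
      rw [LinearMap.mem_ker] at hy ⊢; simp [hy]) g (Submodule.inclusion_injective _) ?_ ?_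
  · intro y
    rw [← map_eq_zero_iff i hi, hg]
    exact ⟨fun h => ⟨⟨y.1, h⟩, rfl⟩, by rintro ⟨z, rfl⟩; exact z.2⟩
  · intro y
    refine ⟨⟨s (i y), ?_⟩, hi ?_⟩
    · simpa [hrs] using (hif _).2 ⟨y, rfl⟩
    · rw [hg]
      simp [hrs]

/-- After `n` finitely generated steps the remaining kernel is finitely generated by `IsFP` and
projective by dimension shifting, so it serves as the last term. -/
lemma IsFP.finRes {n : ℕ} {N : ModuleCat.{u} A} (h : IsFP n N)
    (hN : HasProjectiveDimensionLT N (n + 1)) :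
    FinRes (finProj A) (List.replicate (n + 1) 0) N := by
  induction n generalizing N with
  | zero =>
    exact .of_rank ⟨rfl, projective_of_hasProjectiveDimensionLT hN, h⟩
  | succ n ih =>
    obtain ⟨P, K, i, f, hi, hif, hf, hP, hP', hK⟩ := h
    exact .cons i f hi hif hf ⟨rfl, hP, hP'⟩
      (ih hK (hasProjectiveDimensionLT_kernel i f hi hif hf hN hP))

end ProjectiveDimension

/-! ### Schanuel's lemma, Euler characteristics and stably free modules -/

section Schanuel

variable {A : Type u} [Ring A] {Φ : ℕ → ModuleCat.{u} A → Prop}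

/-- The projection of the pullback `P ×_N Q` to `Q` is surjective with kernel `K`, and it splits
because `Q` is projective. -/
lemma exists_pullback_equiv {K P Q N : Type*} [AddCommGroup K] [AddCommGroup P] [AddCommGroup Q]
    [AddCommGroup N] [Module A K] [Module A P] [Module A Q] [Module A N] (i : K →ₗ[A] P)
    (f : P →ₗ[A] N) (hi : Injective i) (hif : Exact i f) (hf : Surjective f) (g : Q →ₗ[A] N)
    [Module.Projective A Q] :
    Nonempty ((K × Q) ≃ₗ[A] LinearMap.ker (f.coprod (-g))) := by
  obtain ⟨t, ht⟩ := Module.projective_lifting_property f g hf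
  replace ht : ∀ q, f (t q) = g q := LinearMap.congr_fun ht
  refine ⟨LinearEquiv.ofBijective (((i.coprod t).prod (LinearMap.snd A K Q)).codRestrict _ ?_)
    ⟨?_, ?_⟩⟩
  · rintro ⟨k, q⟩
    simp [ht, (hif _).2 ⟨k, rfl⟩]
  · rintro ⟨k, q⟩ ⟨k', q'⟩ h
    have h2 : q = q' := congrArg (fun y => y.1.2) h
    have h1 : i k + t q = i k' + t q' := congrArg (fun y => y.1.1) h
    rw [h2, add_left_inj, hi.eq_iff] at h1
    rw [h1, h2]
  · rintro ⟨⟨p, q⟩, h⟩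
    have h' : f p = g q := by simpa [← sub_eq_add_neg, sub_eq_zero] using h
    obtain ⟨k, hk⟩ := (hif (p - t q)).1 (by simp [ht, h'])
    exact ⟨(k, q), Subtype.ext (by simp [hk])⟩

/-- Schanuel's lemma. -/
lemma schanuel {K P L Q N : Type*} [AddCommGroup K] [AddCommGroup P] [AddCommGroup L]
    [AddCommGroup Q] [AddCommGroup N] [Module A K] [Module A P] [Module A L] [Module A Q]
    [Module A N] (i : K →ₗ[A] P) (f : P →ₗ[A] N) (hi : Injective i) (hif : Exact i f)
    (hf : Surjective f) (j : L →ₗ[A] Q) (g : Q →ₗ[A] N) (hj : Injective j) (hjg : Exact j g)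
    (hg : Surjective g) [Module.Projective A P] [Module.Projective A Q] :
    Nonempty ((K × Q) ≃ₗ[A] (L × P)) := by
  obtain ⟨e⟩ := exists_pullback_equiv i f hi hif hf g
  obtain ⟨e'⟩ := exists_pullback_equiv j g hj hjg hg f
  have swap : LinearMap.ker (f.coprod (-g)) ≃ₗ[A] LinearMap.ker (g.coprod (-f)) :=
    (LinearEquiv.prodComm A P Q).ofSubmodules _ _ (by
      ext ⟨q, p⟩
      simp only [Submodule.mem_map_equiv, LinearMap.mem_ker, LinearMap.coprod_apply,
        LinearMap.neg_apply, ← sub_eq_add_neg, sub_eq_zero]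
      exact eq_comm)
  exact ⟨e.trans (swap.trans e'.symm)⟩

lemma evenSum_append_zero (l : List ℕ) :
    evenSum (l ++ [0]) = evenSum l ∧ oddSum (l ++ [0]) = oddSum l := by
  induction l with
  | nil => exact ⟨rfl, rfl⟩
  | cons a l ih =>
    rw [List.cons_append, evenSum_cons, evenSum_cons, oddSum_cons, oddSum_cons]
    exact ⟨by rw [ih.2], ih.1⟩

lemma length_addHead {a : ℕ} {l : List ℕ} (hl : l ≠ []) : (addHead a l).length = l.length := by
  cases l with
  | nil => exact absurd rfl hl
  | cons b l => rfl

lemma FinRes.pad (hΦ : IsRankedClass Φ) {l : List ℕ} {N : ModuleCat.{u} A} (h : FinRes Φ l N)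
    (k : ℕ) : ∃ l' : List ℕ, l'.length = l.length + k ∧ evenSum l' = evenSum l ∧
      oddSum l' = oddSum l ∧ FinRes Φ l' N := by
  induction k with
  | zero => exact ⟨l, rfl, rfl, rfl, h⟩
  | succ k ih =>
    obtain ⟨l', hl, he, ho, h'⟩ := ih
    exact ⟨l' ++ [0], by simp [hl, add_assoc], (evenSum_append_zero l').1.trans he,
      (evenSum_append_zero l').2.trans ho, h'.append_zero hΦ⟩

/-- Schanuel gives `K ⊕ Q ≅ L ⊕ P` for the first kernels. Adding `Q` and `P` to their resolutions
reduces to length one less, with even and odd interchanged. Only an isomorphism is available there,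
so the induction allows `N ≅ N'`. -/
lemma FinRes.euler_of_length_eq (hΦ : IsRankedClass Φ)
    (huniq : ∀ {k l} {P : ModuleCat.{u} A}, Φ k P → Φ l P → k = l) (n : ℕ) {l l' : List ℕ}
    {N N' : ModuleCat.{u} A} (e : N ≃ₗ[A] N') (h : FinRes Φ l N) (h' : FinRes Φ l' N')
    (hl : l.length = n + 1) (hl' : l'.length = n + 1) :
    evenSum l + oddSum l' = evenSum l' + oddSum l := by
  induction n generalizing l l' N N' with
  | zero =>
    cases h with | nil => simp at hl | @cons a l K P _ i f hi hif hf hP hK =>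
    cases h' with | nil => simp at hl' | @cons b l' L Q _ j g hj hjg hg hQ hL =>
    obtain rfl : l = [] := by simpa using hl
    obtain rfl : l' = [] := by simpa using hl'
    cases hK with | nil hK =>
    cases hL with | nil hL =>
    have bij : ∀ {K P N : ModuleCat.{u} A} (i : K →ₗ[A] P) (f : P →ₗ[A] N), Subsingleton K →
        Exact i f → Surjective f → Bijective f := fun i f _ hif hf =>
      ⟨(injective_iff_map_eq_zero f).2 fun p hp => by
        obtain ⟨k, rfl⟩ := (hif p).1 hp
        rw [Subsingleton.elim k 0, map_zero], hf⟩
    have := huniq (hΦ.congr (((LinearEquiv.ofBijective f (bij i f hK hif hf)).trans e).trans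
      (LinearEquiv.ofBijective g (bij j g hL hjg hg)).symm) hP) hQ
    simp [evenSum, oddSum, this]
  | succ n ih =>
    replace h := h.congr e
    cases h with | nil => simp at hl | @cons a l K P _ i f hi hif hf hP hK =>
    cases h' with | nil => simp at hl' | @cons b l' L Q _ j g hj hjg hg hQ hL =>
    simp only [List.length_cons, add_left_inj] at hl hl'
    have := hΦ.projective hP
    have := hΦ.projective hQ
    obtain ⟨e'⟩ := schanuel i f hi hif hf j g hj hjg hg
    have key := ih (N := ModuleCat.of A (K × Q)) (N' := ModuleCat.of A (L × P)) e'
      (hK.prod hΦ hQ) (hL.prod hΦ hP)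
      (by rw [length_addHead, hl]; rintro rfl; simp at hl)
      (by rw [length_addHead, hl']; rintro rfl; simp at hl')
    simp only [evenSum_addHead, oddSum_addHead] at key
    simp only [evenSum_cons, oddSum_cons]
    omega

/-- The Euler characteristic does not depend on the resolution. -/
lemma FinRes.euler_eq (hΦ : IsRankedClass Φ)
    (huniq : ∀ {k l} {P : ModuleCat.{u} A}, Φ k P → Φ l P → k = l) {l l' : List ℕ}
    {N : ModuleCat.{u} A} (h : FinRes Φ l N) (h' : FinRes Φ l' N) :
    evenSum l + oddSum l' = evenSum l' + oddSum l := by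
  -- Padding each list by the length of the other plus one gives equal positive lengths.
  obtain ⟨l₁, hl₁, he₁, ho₁, h₁⟩ := h.pad hΦ (l'.length + 1)
  obtain ⟨l₂, hl₂, he₂, ho₂, h₂⟩ := h'.pad hΦ (l.length + 1)
  rw [← he₁, ← ho₁, ← he₂, ← ho₂]
  exact FinRes.euler_of_length_eq hΦ huniq (l.length + l'.length) (.refl A N) h₁ h₂
    (by omega) (by omega)

/-- As `N` is projective, `P ≅ K ⊕ N`, and `K` is projective with a shorter free resolution. From `K
⊕ Aᵖ ≅ A^q` it follows that `N ⊕ A^q ≅ P ⊕ Aᵖ`, which is free. -/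
lemma exists_stablyFree {l : List ℕ} {N : ModuleCat.{u} A} (h : FinRes (finFree A) l N)
    (hN : Module.Projective A N) :
    ∃ p q : ℕ, Nonempty ((N × (Fin p → A)) ≃ₗ[A] (Fin q → A)) := by
  induction h with
  | nil h =>
    exact ⟨0, 0, ⟨LinearEquiv.ofBijective 0 ⟨injective_of_subsingleton _,
      fun _ => ⟨0, Subsingleton.elim _ _⟩⟩⟩⟩
  | @cons k l K P N i f hi hif hf hP hK ih =>
    have := isRankedClass_finFree.projective hP
    obtain ⟨e⟩ := schanuel i f hi hif hf (0 : PUnit.{u + 1} →ₗ[A] N) LinearMap.id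
      (injective_of_subsingleton _) (fun y => by simp [eq_comm]) surjective_id
    have e' : (K × N) ≃ₗ[A] P := e.trans LinearEquiv.uniqueProd
    have : Module.Projective A (K × N) := .of_equiv e'.symm
    have : Module.Projective A K :=
      .of_split (LinearMap.inl A K N) (LinearMap.fst A K N) (by ext; rfl)
    obtain ⟨p, q, ⟨g⟩⟩ := ih this
    obtain ⟨r⟩ := isRankedClass_finFree.prod hP
      (show finFree A p (ModuleCat.of A (Fin p → A)) from ⟨.refl _ _⟩)
    refine ⟨q, k + p, ⟨?_⟩⟩
    exact ((LinearEquiv.refl A N).prodCongr g.symm).trans <|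
      (LinearEquiv.prodAssoc A N K (Fin p → A)).symm.trans <|
      (((LinearEquiv.prodComm A N K).trans e').prodCongr (.refl A _)).trans r

/-- A finite free resolution can be shortened to the projective dimension, if this is positive. -/
lemma FinRes.exists_length_eq {l : List ℕ} {N : ModuleCat.{u} A} (h : FinRes (finFree A) l N)
    (n : ℕ) (hN : HasProjectiveDimensionLT N (n + 2)) :
    ∃ l' : List ℕ, l'.length = n + 2 ∧ FinRes (finFree A) l' N := by
  induction n generalizing l N with
  | zero =>
    cases h with
    | nil h =>
      obtain ⟨l', hl', -, -, h'⟩ := (FinRes.nil h).pad isRankedClass_finFree 2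
      exact ⟨l', hl', h'⟩
    | @cons a l K P _ i f hi hif hf hP hK =>
      have hp := isRankedClass_finFree.projective hP
      obtain ⟨p, q, ⟨e⟩⟩ := exists_stablyFree hK (projective_of_hasProjectiveDimensionLT
        (hasProjectiveDimensionLT_kernel i f hi hif hf hN hp))
      -- The kernel `K` is only stably free; adding `Aᵖ` to it and to `P` makes it free. This needs
      -- a term below the last one, hence positive length.
      refine ⟨[a + p, q], rfl, .cons (K := ModuleCat.of A (K × (Fin p → A)))
        (P := ModuleCat.of A (P × (Fin p → A))) (i.prodMap LinearMap.id)
        (f ∘ₗ LinearMap.fst A P (Fin p → A)) (hi.prodMap injective_id) ?_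
        (hf.comp LinearMap.fst_surjective) (isRankedClass_finFree.prod hP
          (show finFree A p (ModuleCat.of A (Fin p → A)) from ⟨.refl _ _⟩)) (.of_rank ⟨e⟩)⟩
      rintro ⟨y, z⟩
      refine (hif y).trans ⟨?_, ?_⟩
      · rintro ⟨k, rfl⟩
        exact ⟨(k, z), rfl⟩
      · rintro ⟨⟨k, z'⟩, h⟩
        exact ⟨k, (Prod.ext_iff.1 h).1⟩
  | succ n ih =>
    cases h with
    | nil h =>
      obtain ⟨l', hl', -, -, h'⟩ := (FinRes.nil h).pad isRankedClass_finFree (n + 3)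
      exact ⟨l', by simpa using hl', h'⟩
    | @cons a l K P _ i f hi hif hf hP hK =>
      have hp := isRankedClass_finFree.projective hP
      obtain ⟨l', hl', h'⟩ := ih hK (hasProjectiveDimensionLT_kernel i f hi hif hf hN hp)
      exact ⟨a :: l', by simp [hl'], .cons i f hi hif hf hP h'⟩

end Schanuel

/-! ### Change of rings along `A → A/xA` -/

section ChangeOfRings

variable {A B : Type u} [Ring A] [Ring B] (φ : A →+* B)

/-- The linear map `Aᵏ → N` induced by a linear map `Bᵏ → N`. -/
def restrictFree {k : ℕ} {N : ModuleCat.{u} B} (f : (Fin k → B) →ₗ[B] N) :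
    (Fin k → A) →ₗ[A] (ModuleCat.restrictScalars φ).obj N where
  toFun a := f fun i => φ (a i)
  map_add' a b := (congrArg f (funext fun _ => map_add φ _ _)).trans
    (map_add f (fun i => φ (a i)) fun i => φ (b i))
  map_smul' a b := (congrArg f (funext fun _ => map_mul φ _ _)).trans
    (map_smul f (φ a) fun i => φ (b i))

variable {φ}

lemma restrictFree_surjective (hφ : Surjective φ) {k : ℕ} {N : ModuleCat.{u} B}
    {f : (Fin k → B) →ₗ[B] N} (hf : Surjective f) : Surjective (restrictFree φ f) := fun y => by
  obtain ⟨b, rfl⟩ := hf y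
  exact ⟨fun i => (hφ (b i)).choose, congrArg f (funext fun i => (hφ (b i)).choose_spec)⟩

/-- If `K = ker (Bᵏ → N)`, then the kernel of `Aᵏ → Bᵏ → N` is an extension of `K` by `xAᵏ`, and
`xAᵏ ≅ Aᵏ` since `x` is a nonzerodivisor. Induction applies to `K`. -/
lemma IsFP.restrictScalars (hφ : Surjective φ) {x : A} (hx : ∀ a, a * x = x * a)
    (hx0 : ∀ a, x * a = 0 → a = 0) (hker : ∀ a, φ a = 0 ↔ ∃ a', x * a' = a) {m : ℕ}
    {N : ModuleCat.{u} B} (h : IsFP m N) : IsFP m ((ModuleCat.restrictScalars φ).obj N) := by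
  induction m generalizing N with
  | zero =>
    have : Module.Finite B N := h
    obtain ⟨k, f, hf⟩ := Module.Finite.exists_fin' B N
    exact Module.Finite.of_surjective _ (restrictFree_surjective hφ hf)
  | succ m ih =>
    obtain ⟨k, K, i, f, hi, hif, hf, hK⟩ := h.exists_free
    let F := restrictFree φ f
    have hF : ∀ a, F a = f fun j => φ (a j) := fun a => rfl
    let g : LinearMap.ker F → K := fun a => ((hif _).1 a.2).choose
    have hg : ∀ a : LinearMap.ker F, i (g a) = fun j => φ (a.1 j) := fun a =>
      ((hif _).1 a.2).choose_spec
    let G : LinearMap.ker F →ₗ[A] (ModuleCat.restrictScalars φ).obj K :=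
      { toFun := g
        map_add' := fun a b => hi <| by
          refine (hg _).trans (Eq.trans ?_ (map_add i (g a) (g b)).symm)
          rw [hg, hg]
          exact funext fun j => map_add φ _ _
        map_smul' := fun a b => hi <| by
          refine (hg _).trans (Eq.trans ?_ (map_smul i (φ a) (g b)).symm)
          rw [hg]
          exact funext fun j => map_mul φ _ _ }
    have hxφ : φ x = 0 := (hker x).2 ⟨1, mul_one x⟩
    refine ⟨ModuleCat.of A (Fin k → A), ModuleCat.of A (LinearMap.ker F), Submodule.subtype _, F,
      Subtype.val_injective, LinearMap.exact_subtype_ker_map _, restrictFree_surjective hφ hf,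
      inferInstance, inferInstance, ?_⟩
    refine (ih hK).of_extension (F := ModuleCat.of A (Fin k → A))
      (L := ModuleCat.of A (LinearMap.ker F))
      ((centralMul x hx (Fin k → A)).codRestrict _ fun a => ?_) G ?_ ?_ ?_
    · rw [LinearMap.mem_ker, hF]
      have : (fun j => φ ((centralMul x hx (Fin k → A)) a j)) = 0 := funext fun j => by
        simp [centralMul, hxφ]
      rw [this]
      exact map_zero f
    · refine (injective_iff_map_eq_zero _).2 fun a ha => ?_
      exact funext fun j => hx0 _ (congrFun (congrArg Subtype.val ha) j)
    · intro y
      rw [show (G y = 0 ↔ i (g y) = 0) from (map_eq_zero_iff i hi).symm, hg]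
      constructor
      · intro h
        choose a ha using fun j => (hker _).1 (congrFun h j)
        exact ⟨a, Subtype.ext (funext ha)⟩
      · rintro ⟨a, rfl⟩
        exact funext fun j => (hker _).2 ⟨a j, rfl⟩
    · intro y
      choose a ha using fun j => hφ (i y j)
      have ha' : (fun j => φ (a j)) = i y := funext ha
      refine ⟨⟨a, ?_⟩, hi ?_⟩
      · rw [LinearMap.mem_ker, hF, ha']
        exact (hif _).2 ⟨y, rfl⟩
      · exact (hg _).trans ha'

section Descent

variable (hφ : Surjective φ)

/-- The structure of a `B`-module on an `A`-module annihilated by the kernel of `A → B`. -/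
noncomputable abbrev descendModule (M : ModuleCat.{u} A)
    (hM : ∀ a, φ a = 0 → ∀ m : M, a • m = 0) : Module B M :=
  have key : ∀ {a a' : A}, φ a = φ a' → ∀ m : M, a • m = a' • m := fun {a a'} h m => by
    rw [← sub_eq_zero, ← sub_smul]
    exact hM _ (by rw [map_sub, h, sub_self]) m
  { smul := fun b m => surjInv hφ b • m
    one_smul := fun m => (key (by rw [surjInv_eq hφ, map_one]) m).trans (one_smul A m)
    mul_smul := fun b b' m =>
      (key (by rw [map_mul]; simp only [surjInv_eq hφ]) m).trans (mul_smul (surjInv hφ b) _ m)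
    smul_zero := fun b => smul_zero _
    smul_add := fun b => smul_add _
    add_smul := fun b b' m =>
      (key (by rw [map_add]; simp only [surjInv_eq hφ]) m).trans (add_smul (surjInv hφ b) _ m)
    zero_smul := fun m => hM _ (surjInv_eq hφ 0) m }

/-- The `B`-module given by an `A`-module annihilated by the kernel of `A → B`. -/
noncomputable def descend (M : ModuleCat.{u} A) (hM : ∀ a, φ a = 0 → ∀ m : M, a • m = 0) :
    ModuleCat.{u} B :=
  @ModuleCat.of B _ M _ (descendModule hφ M hM)

/-- The comparison of an `A`-module with the `B`-module that it gives. -/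
noncomputable def descendEquiv (M : ModuleCat.{u} A)
    (hM : ∀ a, φ a = 0 → ∀ m : M, a • m = 0) :
    M ≃ₗ[A] (ModuleCat.restrictScalars φ).obj (descend hφ M hM) where
  toFun m := m
  invFun m := m
  left_inv _ := rfl
  right_inv _ := rfl
  map_add' _ _ := rfl
  map_smul' a m := by
    change a • m = surjInv hφ (φ a) • m
    rw [← sub_eq_zero, ← sub_smul]
    exact hM _ (by rw [map_sub, surjInv_eq hφ, sub_self]) m

/-- As `A → B` is surjective, `A`-linear maps between `B`-modules are `B`-linear. -/
noncomputable def linearOfRestrict {M N : ModuleCat.{u} B}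
    (f : (ModuleCat.restrictScalars φ).obj M →ₗ[A] (ModuleCat.restrictScalars φ).obj N) :
    M →ₗ[B] N where
  toFun m := f m
  map_add' := map_add f
  map_smul' b m := by
    obtain ⟨a, rfl⟩ := hφ b
    exact f.map_smul a m

/-- As `A → B` is surjective, `A`-linear equivalences between `B`-modules are `B`-linear. -/
noncomputable def equivOfRestrict {M N : ModuleCat.{u} B}
    (e : (ModuleCat.restrictScalars φ).obj M ≃ₗ[A] (ModuleCat.restrictScalars φ).obj N) :
    M ≃ₗ[B] N :=
  { linearOfRestrict hφ e.toLinearMap with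
    invFun := e.symm
    left_inv := e.left_inv
    right_inv := e.right_inv }

/-- A resolution of a `B`-module by `A`-modules annihilated by the kernel of `A → B`, as a
resolution by `B`-modules. -/
noncomputable def SeqRes.descend {N : ModuleCat.{u} B}
    (S : SeqRes ((ModuleCat.restrictScalars φ).obj N))
    (hS : ∀ j a, φ a = 0 → ∀ m : S.X j, a • m = 0) : SeqRes N where
  X j := CentralQuotient.descend hφ (S.X j) (hS j)
  d j := linearOfRestrict hφ ((descendEquiv hφ _ (hS j)).toLinearMap ∘ₗ S.d j ∘ₗ
    (descendEquiv hφ _ (hS (j + 1))).symm.toLinearMap)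
  ε := linearOfRestrict hφ (S.ε ∘ₗ (descendEquiv hφ _ (hS 0)).symm.toLinearMap)
  surjective := S.surjective
  exact_zero := S.exact_zero
  exact := S.exact

lemma SeqRes.IsPeriodicFrom.descend {N : ModuleCat.{u} B}
    {S : SeqRes ((ModuleCat.restrictScalars φ).obj N)} {m : ℕ} (h : S.IsPeriodicFrom m)
    (hS : ∀ j a, φ a = 0 → ∀ m : S.X j, a • m = 0) :
    (S.descend hφ hS).IsPeriodicFrom m := by
  obtain ⟨e, he⟩ := h
  exact ⟨fun j hj => equivOfRestrict hφ ((descendEquiv hφ _ (hS j)).symm.trans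
    ((e j hj).trans (descendEquiv hφ _ (hS (j + 2))))), he⟩

variable {x : A} {hx : ∀ a, a * x = x * a}
lemma finFree_of_reduction (hφ : Surjective φ) (hker : ∀ a, φ a = 0 ↔ ∃ a', x * a' = a) {k : ℕ}
    {P : ModuleCat.{u} A} {D : ModuleCat.{u} B}
    (hP : finFree A k P) (e : (ModuleCat.restrictScalars φ).obj D ≃ₗ[A] reduction x hx P) :
    finFree B k D := by
  obtain ⟨r⟩ := hP
  let q : P →ₗ[A] (ModuleCat.restrictScalars φ).obj (ModuleCat.of B (Fin k → B)) :=
    restrictFree φ (N := ModuleCat.of B (Fin k → B)) LinearMap.id ∘ₗ r.toLinearMap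
  have hq : Surjective q :=
    (restrictFree_surjective (N := ModuleCat.of B (Fin k → B)) (f := LinearMap.id) hφ
      surjective_id).comp r.surjective
  have hqk : LinearMap.range (centralMul x hx P) = LinearMap.ker q := by
    ext p
    constructor
    · rintro ⟨p, rfl⟩
      refine funext fun i => (hker _).2 ⟨r p i, ?_⟩
      exact (congrFun (map_smul r x p) i).symm
    · intro h
      choose a ha using fun i => (hker _).1 (congrFun h i)
      refine ⟨r.symm a, r.injective ?_⟩
      refine (map_smul r x _).trans ?_
      rw [r.apply_symm_apply]
      exact funext ha
  exact ⟨equivOfRestrict hφ (N := ModuleCat.of B (Fin k → B)) (e.trans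
    ((Submodule.quotEquivOfEq _ _ hqk).trans (q.quotKerEquivOfSurjective hq)))⟩

/-- To split a map from a free `B`-module `E` onto `D ≅ P/xP`, lift `P → D` to `E` over `A`. The
lift kills `xP` because `x` acts as zero on `E`, so it descends to a `B`-linear section. -/
lemma finProj_of_reduction (hφ : Surjective φ) (hker : ∀ a, φ a = 0 ↔ ∃ a', x * a' = a) {k : ℕ}
    {P : ModuleCat.{u} A} {D : ModuleCat.{u} B}
    (hP : finProj A k P) (e : (ModuleCat.restrictScalars φ).obj D ≃ₗ[A] reduction x hx P) :
    finProj B k D := by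
  obtain ⟨hk, hproj, hfin⟩ := hP
  refine ⟨hk, .of_lifting_property'' fun f hf => ?_, ?_⟩
  · let E : ModuleCat.{u} B := ModuleCat.of B (D →₀ B)
    let f' : (ModuleCat.restrictScalars φ).obj E →ₗ[A] (ModuleCat.restrictScalars φ).obj D :=
      { toFun := f
        map_add' := map_add f
        map_smul' := fun a => map_smul f (φ a) }
    obtain ⟨g, hg⟩ := Module.projective_lifting_property f'
      (e.symm.toLinearMap ∘ₗ Submodule.mkQ _) hf
    let h : reduction x hx P →ₗ[A] (ModuleCat.restrictScalars φ).obj E :=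
      Submodule.liftQ _ g (by
        rintro _ ⟨p, rfl⟩
        refine (map_smul g x p).trans ?_
        change φ x • (g p : E) = 0
        rw [(hker x).2 ⟨1, mul_one x⟩, zero_smul])
    refine ⟨linearOfRestrict hφ (N := E) (h ∘ₗ e.toLinearMap), LinearMap.ext fun d => ?_⟩
    change f' (h (e d)) = d
    obtain ⟨p, hp⟩ := Submodule.mkQ_surjective _ (e d)
    rw [← hp]
    refine (LinearMap.congr_fun hg p).trans ?_
    rw [LinearMap.comp_apply, hp]
    exact e.symm_apply_apply d
  · have : RingHomSurjective φ := ⟨hφ⟩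
    let s : P →ₛₗ[φ] D :=
      { toFun := fun p => e.symm (Submodule.mkQ _ p)
        map_add' := fun p p' => by rw [map_add, map_add]; rfl
        map_smul' := fun a p => by rw [map_smul, map_smul]; rfl }
    exact Module.Finite.of_surjective s (e.symm.surjective.comp (Submodule.mkQ_surjective _))

end Descent

end ChangeOfRings

/-! ### The element `c - 1` and the group ring of the quotient -/

section GroupRing

open MonoidAlgebra

variable {G : Type u} [Group G]

/-- The element `c - 1` of the group ring. -/
noncomputable def subOne (c : G) : MonoidAlgebra ℤ G := single c 1 - 1

lemma mul_subOne {c : G} (hc : c ∈ Subgroup.center G) (a : MonoidAlgebra ℤ G) :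
    a * subOne c = subOne c * a := by
  have : Commute (single c 1 : MonoidAlgebra ℤ G) a :=
    of_commute (fun g => (Subgroup.mem_center_iff.1 hc g).symm) a
  rw [subOne, mul_sub, sub_mul, this.eq, mul_one, one_mul]

lemma coeff_eq_of_subOne_mul_eq_zero {c : G} {a : MonoidAlgebra ℤ G} (h : subOne c * a = 0)
    (n : ℕ) (g : G) : a.coeff (c ^ n * g) = a.coeff g := by
  have h1 : ∀ g, a.coeff (c * g) = a.coeff g := fun g => by
    rw [subOne, sub_mul, one_mul, sub_eq_zero] at h
    have := coeff_single_mul_apply a 1 c (c * g)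
    rw [h] at this
    simpa using this
  induction n with
  | zero => simp
  | succ n ih => rw [pow_succ', mul_assoc, h1, ih]

/-- An element killed by `c - 1` has constant coefficients along the sets `{cⁿ g}`. These are
infinite, while the support is finite. -/
lemma eq_zero_of_subOne_mul_eq_zero {c : G} (hc : ¬ IsOfFinOrder c) {a : MonoidAlgebra ℤ G}
    (h : subOne c * a = 0) : a = 0 := by
  by_contra ha
  have : ∃ g, a.coeff g ≠ 0 := by
    by_contra! h0
    exact ha (coeff_injective (Finsupp.ext h0))
  obtain ⟨g, hg⟩ := this
  have hinj : Injective fun n : ℕ => c ^ n * g := fun m n hmn =>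
    injective_pow_iff_not_isOfFinOrder.2 hc (mul_right_cancel hmn)
  refine Set.infinite_range_of_injective hinj (a.coeff.support.finite_toSet.subset ?_)
  rintro _ ⟨n, rfl⟩
  simpa [coeff_eq_of_subOne_mul_eq_zero h] using hg

lemma exists_subOne_mul_eq_zpow {c : G} (k : ℤ) :
    ∃ y : MonoidAlgebra ℤ G, subOne c * y = single (c ^ k) 1 - 1 := by
  induction k with
  | zero => exact ⟨0, by simp [one_def]⟩
  | succ k ih =>
    obtain ⟨y, hy⟩ := ih
    refine ⟨y + single (c ^ (k : ℤ)) 1, ?_⟩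
    rw [mul_add, hy, subOne, sub_mul, single_mul_single, one_mul, zpow_add_one, one_mul,
      ← zpow_one_add, ← zpow_add_one, add_comm (k : ℤ) 1]
    abel
  | pred k ih =>
    obtain ⟨y, hy⟩ := ih
    refine ⟨y - single (c ^ (-(k : ℤ) - 1)) 1, ?_⟩
    rw [mul_sub, hy, subOne, sub_mul, single_mul_single, one_mul, one_mul, ← zpow_one_add,
      add_sub_cancel]
    abel

/-- The projection of group rings `ℤ[G] → ℤ[G / ⟨c⟩]`. -/
noncomputable abbrev groupRingProj (c : Subgroup.center G) :
    MonoidAlgebra ℤ G →+* MonoidAlgebra ℤ (CQuot G c) :=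
  mapDomainRingHom ℤ (QuotientGroup.mk' (Subgroup.zpowers (c : G)))

lemma groupRingProj_single (c : Subgroup.center G) (g : G) (n : ℤ) :
    groupRingProj c (single g n) = single (g : CQuot G c) n :=
  mapDomain_single

lemma groupRingProj_surjective (c : Subgroup.center G) : Surjective (groupRingProj c) := fun b => by
  induction b using induction_linear with
  | zero => exact ⟨0, map_zero _⟩
  | add b b' h h' =>
    obtain ⟨a, rfl⟩ := h
    obtain ⟨a', rfl⟩ := h'
    exact ⟨a + a', map_add _ _ _⟩
  | single q n =>
    obtain ⟨g, rfl⟩ := QuotientGroup.mk_surjective q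
    exact ⟨single g n, groupRingProj_single c g n⟩

/-- The additive section of `ℤ[G] → ℤ[G / ⟨c⟩]` given by coset representatives. -/
noncomputable def cosetSection (c : Subgroup.center G) :
    MonoidAlgebra ℤ (CQuot G c) →+ MonoidAlgebra ℤ G where
  toFun := mapDomain Quotient.out
  map_zero' := mapDomain_zero _
  map_add' := mapDomain_add _

lemma exists_eq_zpow_mul_out (c : Subgroup.center G) (g : G) :
    ∃ k : ℤ, (g : CQuot G c).out = (c : G) ^ k * g := by
  have : g⁻¹ * (g : CQuot G c).out ∈ Subgroup.zpowers (c : G) :=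
    QuotientGroup.eq.1 (QuotientGroup.out_eq' _).symm
  obtain ⟨k, hk⟩ := this
  refine ⟨k, ?_⟩
  rw [← Subgroup.mem_center_iff.1 (zpow_mem c.2 k) g]
  exact (eq_mul_of_inv_mul_eq hk.symm).trans rfl

/-- Modulo `c - 1` every group element equals its coset representative, as `cᵏ - 1` is a multiple of
`c - 1`. This identifies the kernel of `ℤG → ℤΓ`. -/
lemma exists_subOne_mul_eq_sub_cosetSection (c : Subgroup.center G) (a : MonoidAlgebra ℤ G) :
    ∃ y, subOne (c : G) * y = a - cosetSection c (groupRingProj c a) := by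
  induction a using induction_linear with
  | zero => exact ⟨0, by simp⟩
  | add a b ha hb =>
    obtain ⟨y, hy⟩ := ha
    obtain ⟨z, hz⟩ := hb
    exact ⟨y + z, by rw [mul_add, hy, hz, map_add, map_add]; abel⟩
  | single g n =>
    obtain ⟨k, hk⟩ := exists_eq_zpow_mul_out c g
    obtain ⟨y, hy⟩ := exists_subOne_mul_eq_zpow (c := (c : G)) k
    refine ⟨-(y * single g n), ?_⟩
    rw [mul_neg, ← mul_assoc, hy, groupRingProj_single,
      show cosetSection c (single (g : CQuot G c) n) = single (g : CQuot G c).out n from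
        mapDomain_single, hk, sub_mul, single_mul_single, one_mul, one_mul]
    abel

lemma groupRingProj_subOne (c : Subgroup.center G) : groupRingProj c (subOne (c : G)) = 0 := by
  have : ((c : G) : CQuot G c) = 1 :=
    (QuotientGroup.eq_one_iff _).2 (Subgroup.mem_zpowers _)
  rw [subOne, map_sub, map_one, groupRingProj_single, this, one_def, sub_self]

lemma groupRingProj_eq_zero_iff (c : Subgroup.center G) (a : MonoidAlgebra ℤ G) :
    groupRingProj c a = 0 ↔ ∃ y, subOne (c : G) * y = a := by
  constructor
  · intro h
    obtain ⟨y, hy⟩ := exists_subOne_mul_eq_sub_cosetSection c a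
    exact ⟨y, by rw [hy, h, map_zero, sub_zero]⟩
  · rintro ⟨y, rfl⟩
    rw [map_mul, groupRingProj_subOne, zero_mul]

/-- The coefficient at `1` is a trace because `gh = 1` if and only if `hg = 1`. -/
lemma coeff_mul_one_comm (a b : MonoidAlgebra ℤ G) : (a * b).coeff 1 = (b * a).coeff 1 := by
  induction a using induction_linear with
  | zero => simp
  | add a a' h h' => rw [add_mul, mul_add, coeff_add, coeff_add, Finsupp.add_apply, h, h']; rfl
  | single g n => simp [mul_comm]

/-- If `c - 1` is factored as a product of matrices in both orders, the matrices are square. -/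
lemma finFree_rank_eq {c : G} (hc : c ≠ 1) {k l : ℕ} {P Q : ModuleCat.{u} (MonoidAlgebra ℤ G)}
    (hP : finFree _ k P) (hQ : finFree _ l Q) (f : P →ₗ[MonoidAlgebra ℤ G] Q)
    (g : Q →ₗ[MonoidAlgebra ℤ G] P) (hgf : ∀ p, g (f p) = subOne c • p)
    (hfg : ∀ q, f (g q) = subOne c • q) : k = l := by
  obtain ⟨e⟩ := hP
  obtain ⟨e'⟩ := hQ
  -- The trace of `x` times the identity on a free module of rank `k` is `-k`, since `c ≠ 1` makes
  -- the coefficient of `c - 1` at `1` equal to `-1`.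
  have trace : ∀ {k l : ℕ} (f : (Fin k → MonoidAlgebra ℤ G) →ₗ[MonoidAlgebra ℤ G]
      (Fin l → MonoidAlgebra ℤ G)) (g : (Fin l → MonoidAlgebra ℤ G) →ₗ[MonoidAlgebra ℤ G]
      (Fin k → MonoidAlgebra ℤ G)), (∀ p, g (f p) = subOne c • p) →
      ∑ i, ∑ j, (f (Pi.single i 1) j * g (Pi.single j 1) i).coeff 1 = -(k : ℤ) := by
    intro k l f g h
    have h1 : (subOne c : MonoidAlgebra ℤ G).coeff 1 = -1 := by
      simp [subOne, one_def, hc]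
    have : ∀ i, ∑ j, (f (Pi.single i 1) j * g (Pi.single j 1) i).coeff 1 = -1 := fun i => by
      have h2 := congrFun (h (Pi.single i 1)) i
      rw [Pi.smul_apply, Pi.single_eq_same, smul_eq_mul, mul_one,
        pi_eq_sum_univ' (f (Pi.single i 1)), map_sum, Finset.sum_apply] at h2
      rw [← h1, ← h2, coeff_sum, Finset.sum_apply']
      refine Finset.sum_congr rfl fun j _ => ?_
      rw [map_smul, Pi.smul_apply, smul_eq_mul]
    simp [this]
  let f' := e'.toLinearMap ∘ₗ f ∘ₗ e.symm.toLinearMap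
  let g' := e.toLinearMap ∘ₗ g ∘ₗ e'.symm.toLinearMap
  have h1 := trace f' g' fun p => by simp [f', g', hgf]
  have h2 := trace g' f' fun p => by simp [f', g', hfg]
  rw [Finset.sum_comm] at h2
  simp only [coeff_mul_one_comm (g' _ _)] at h2
  have := h1.symm.trans h2
  omega

end GroupRing

/-! ### Central elements of finite order and Tate cohomology -/

section FiniteOrder

open MonoidAlgebra

variable {G : Type u} [Group G]

/-- The norm element `1 + c + ⋯ + c ^ (m - 1)`, where `m` is the order of `c`. -/
noncomputable def normElt (c : G) : MonoidAlgebra ℤ G :=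
  ∑ i ∈ Finset.range (orderOf c), (single c 1) ^ i

lemma normElt_mul_subOne (c : G) : normElt c * subOne c = 0 := by
  rw [normElt, subOne, geom_sum_mul, single_pow, pow_orderOf_eq_one, one_pow, one_def, sub_self]

lemma groupRingProj_normElt (c : Subgroup.center G) :
    groupRingProj c (normElt (c : G)) = (orderOf (c : G) : MonoidAlgebra ℤ (CQuot G c)) := by
  have : groupRingProj c (single (c : G) 1) = 1 := by
    have := groupRingProj_subOne c
    rwa [subOne, map_sub, map_one, sub_eq_zero] at this
  simp only [normElt, map_sum, map_pow, this, one_pow, Finset.sum_const, Finset.card_range,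
    nsmul_one]

lemma smul_injective_groupRing {m : ℕ} (hm : m ≠ 0) {a : MonoidAlgebra ℤ G}
    (h : (m : MonoidAlgebra ℤ G) * a = 0) : a = 0 := by
  refine coeff_injective (Finsupp.ext fun g => ?_)
  have := congrArg (fun b => b.coeff g) h
  rw [natCast_def] at this
  simpa [hm] using this

/-- The norm element maps to the order of `c` in `ℤΓ`, which is torsion-free, so `a` maps to zero
there. -/
lemma exists_subOne_mul_of_normElt_mul {c : Subgroup.center G} (hc : IsOfFinOrder (c : G))
    {a : MonoidAlgebra ℤ G} (h : normElt (c : G) * a = 0) : ∃ y, subOne (c : G) * y = a := by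
  rw [← groupRingProj_eq_zero_iff]
  have := congrArg (groupRingProj c) h
  rw [map_mul, groupRingProj_normElt, map_zero] at this
  exact smul_injective_groupRing hc.orderOf_pos.ne' this

open scoped Classical in
/-- The part of an element of the group ring supported on the chosen coset representatives. -/
noncomputable def cosetPart (c : Subgroup.center G) : MonoidAlgebra ℤ G →+ MonoidAlgebra ℤ G where
  toFun a := ofCoeff (a.coeff.filter fun g => (g : CQuot G c).out = g)
  map_zero' := by rw [coeff_zero, Finsupp.filter_zero, ofCoeff_zero]
  map_add' a b := by rw [coeff_add, Finsupp.filter_add, ofCoeff_add]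

/-- Among the translates `cⁱ g` with `i` below the order of `c`, exactly one is the chosen
representative of the coset of `g`. -/
lemma sum_cosetPart {c : Subgroup.center G} (hc : IsOfFinOrder (c : G)) (a : MonoidAlgebra ℤ G) :
    ∑ i ∈ Finset.range (orderOf (c : G)), cosetPart c (single ((c : G) ^ i) 1 * a) =
      cosetSection c (groupRingProj c a) := by
  classical
  induction a using induction_linear with
  | zero => simp
  | add a b ha hb => simp only [mul_add, map_add, Finset.sum_add_distrib, ha, hb]
  | single g n =>
    have hq : ∀ i : ℕ, (((c : G) ^ i * g : G) : CQuot G c) = g := fun i => by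
      rw [QuotientGroup.mk_mul, (QuotientGroup.eq_one_iff _).2
        (Subgroup.pow_mem _ (Subgroup.mem_zpowers _) i), one_mul]
    have hpart : ∀ i : ℕ, cosetPart c (single ((c : G) ^ i) 1 * single g n) =
        if (g : CQuot G c).out = (c : G) ^ i * g then single (g : CQuot G c).out n else 0 := by
      intro i
      rw [single_mul_single, one_mul]
      change ofCoeff (Finsupp.filter (fun g : G => (g : CQuot G c).out = g)
        (Finsupp.single ((c : G) ^ i * g) n)) = _
      split_ifs with h
      · rw [Finsupp.filter_single_of_pos _ (by rw [hq, h]), h]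
        rfl
      · rw [Finsupp.filter_single_of_neg _ (by rwa [hq])]
        rfl
    simp only [hpart]
    obtain ⟨k, hk⟩ := exists_eq_zpow_mul_out c g
    have : (c : G) ^ k ∈ Subgroup.zpowers (c : G) := ⟨k, rfl⟩
    rw [← hc.mem_powers_iff_mem_zpowers, hc.mem_powers_iff_mem_range_orderOf,
      Finset.mem_image] at this
    obtain ⟨i, hi, hik⟩ := this
    rw [Finset.sum_eq_single_of_mem i hi, if_pos (by rw [hk, hik]), groupRingProj_single]
    · exact mapDomain_single.symm
    · intro j hj hji
      rw [if_neg]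
      intro h
      rw [hk, ← hik, mul_left_inj] at h
      exact hji (pow_injOn_Iio_orderOf (Finset.mem_range.1 hj) (Finset.mem_range.1 hi) h.symm)

/-- For invariant `a` and `m` the order of `c`, the coset section of the image of `a` is `m` times
`cosetPart c a`. The norm kills its difference from `a` and multiplies `a` by `m`; cancelling `m`
exhibits `a` as the norm of `cosetPart c a`. -/
lemma exists_normElt_mul_of_subOne_mul {c : Subgroup.center G} (hc : IsOfFinOrder (c : G))
    {a : MonoidAlgebra ℤ G} (h : subOne (c : G) * a = 0) : ∃ y, normElt (c : G) * y = a := by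
  have h1 : ∀ i : ℕ, (single (c : G) 1) ^ i * a = a := fun i => by
    induction i with
    | zero => simp
    | succ i ih =>
      rw [subOne, sub_mul, one_mul, sub_eq_zero] at h
      rw [pow_succ, mul_assoc, h, ih]
  have h2 := sum_cosetPart hc a
  have h1' : ∀ i : ℕ, single ((c : G) ^ i) 1 * a = a := fun i => by
    simpa only [single_pow, one_pow] using h1 i
  simp only [h1', Finset.sum_const, Finset.card_range] at h2
  obtain ⟨y, hy⟩ := exists_subOne_mul_eq_sub_cosetSection c a
  have h3 : normElt (c : G) * a = (orderOf (c : G) : MonoidAlgebra ℤ G) * a := by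
    simp only [normElt, Finset.sum_mul, h1, Finset.sum_const, Finset.card_range, nsmul_eq_mul]
  have h4 := congrArg (normElt (c : G) * ·) hy
  simp only [← mul_assoc, normElt_mul_subOne, zero_mul, mul_sub, h3, ← h2] at h4
  refine ⟨cosetPart c a, (sub_eq_zero.1 (smul_injective_groupRing hc.orderOf_pos.ne' ?_)).symm⟩
  rw [mul_sub, h4, nsmul_eq_mul, ← mul_assoc (normElt _), ← mul_assoc,
    (Nat.cast_commute (orderOf (c : G)) (normElt (c : G))).eq]

/-- The Tate cohomology of `⟨c⟩` with coefficients in a module with a finite projective resolution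
over `ℤ[G]` vanishes. -/
lemma FinRes.tate {c : Subgroup.center G} (hc : IsOfFinOrder (c : G)) {l : List ℕ}
    {N : ModuleCat.{u} (MonoidAlgebra ℤ G)} (h : FinRes (finProj _) l N) :
    (∀ n : N, subOne (c : G) • n = 0 → ∃ y : N, normElt (c : G) • y = n) ∧
      ∀ n : N, normElt (c : G) • n = 0 → ∃ y : N, subOne (c : G) • y = n := by
  induction h with
  | nil h => exact ⟨fun n _ => ⟨0, Subsingleton.elim _ _⟩, fun n _ => ⟨0, Subsingleton.elim _ _⟩⟩
  | @cons k l K P N i f hi hif hf hP hK ih =>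
    -- Dimension shifting, symmetric in the norm and `c - 1`: lift `n` to `p`, correct `p` by an
    -- element of `K` so that `a` kills it, then use exactness in a free module containing `P` as a
    -- summand.
    have key : ∀ {a b : MonoidAlgebra ℤ G}, a * b = 0 → b * a = 0 →
        (∀ r, b * r = 0 → ∃ y, a * y = r) → (∀ r, a * r = 0 → ∃ y, b * y = r) →
        (∀ k : K, b • k = 0 → ∃ y : K, a • y = k) → ∀ n : N, a • n = 0 → ∃ y : N, b • y = n := by
      intro a b hab hba hA hA' hK n hn
      obtain ⟨-, _, _⟩ := hP
      obtain ⟨m, r, s, hr, hs, hrs⟩ :=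
        Module.Finite.exists_comp_eq_id_of_projective (MonoidAlgebra ℤ G) P
      obtain ⟨p, rfl⟩ := hf n
      obtain ⟨k, hk⟩ := (hif (a • p)).1 (by rw [map_smul, hn])
      obtain ⟨k', rfl⟩ := hK k (hi (by rw [map_smul, hk, ← mul_smul, hba, zero_smul, map_zero]))
      rw [map_smul] at hk
      have h1 : a • s (p - i k') = 0 := by rw [← map_smul, smul_sub, hk, sub_self, map_zero]
      choose y hy using fun j => hA' _ (congrFun h1 j)
      refine ⟨f (r y), ?_⟩
      have h2 : b • r y = p - i k' := by
        rw [← map_smul, show b • y = s (p - i k') from funext hy]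
        exact LinearMap.congr_fun hrs _
      rw [← map_smul, h2, map_sub, (hif _).2 ⟨k', rfl⟩, sub_zero]
    have h0 : subOne (c : G) * normElt (c : G) = 0 := by
      rw [← mul_subOne c.2, normElt_mul_subOne]
    exact ⟨key h0 (normElt_mul_subOne _) (fun r => exists_subOne_mul_of_normElt_mul hc)
        (fun r => exists_normElt_mul_of_subOne_mul hc) ih.2,
      key (normElt_mul_subOne _) h0 (fun r => exists_normElt_mul_of_subOne_mul hc)
        (fun r => exists_subOne_mul_of_normElt_mul hc) ih.1⟩

lemma single_smul_trivialModule (g : G) (n : ℤ) (z : trivialModule G) :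
    (single g n : MonoidAlgebra ℤ G) • z = n • z :=
  Representation.single_smul (Representation.trivial ℤ G (ULift.{u} ℤ)) n g z

lemma subOne_smul_trivialModule (c : G) (z : trivialModule G) :
    (subOne c : MonoidAlgebra ℤ G) • z = 0 := by
  rw [subOne, sub_smul, single_smul_trivialModule, one_smul, one_smul, sub_self]

/-- Nontrivial central elements of a group of type `FP` have infinite order. -/
lemma not_isOfFinOrder {c : Subgroup.center G} (hc : c ≠ 1) {l : List ℕ}
    (h : FinRes (finProj _) l (trivialModule G)) : ¬ IsOfFinOrder (c : G) := fun hfin => by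
  -- The invariant element `1` of `ℤ` would be a norm, that is, a multiple of the order of `c`.
  obtain ⟨y, hy⟩ := (h.tate hfin).1 (ULift.up 1 : ULift.{u} ℤ) (subOne_smul_trivialModule _ _)
  have h1 : normElt (c : G) • y = (orderOf (c : G) : ℤ) • y := by
    rw [normElt, Finset.sum_smul, natCast_zsmul, ← Finset.card_range (orderOf (c : G)),
      ← Finset.sum_const, Finset.card_range]
    exact Finset.sum_congr rfl fun i _ => by
      rw [single_pow, single_smul_trivialModule, one_pow, one_smul]
  rw [h1] at hy
  have h2 : (orderOf (c : G) : ℤ) * (show ULift.{u} ℤ from y).down = 1 := congrArg ULift.down hy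
  have h3 : orderOf (c : G) = 1 := by
    have := Int.natAbs_dvd_natAbs.2 (Dvd.intro _ h2)
    simpa using this
  exact hc (Subtype.ext (orderOf_eq_one_iff.1 h3))

end FiniteOrder

/-! ### Subgroups of projective abelian groups -/

section IntegralProjective

/-- Subgroups of projective abelian groups are projective. -/
lemma projective_int_of_injective {K F : Type*} [AddCommGroup K] [AddCommGroup F]
    [Module.Projective ℤ F] (i : K →ₗ[ℤ] F) (hi : Injective i) : Module.Projective ℤ K := by
  refine .of_lifting_property'' fun f hf => ?_
  let j : (K →₀ ℤ) →ₗ[ℤ] (K →₀ ℚ) := Finsupp.mapRange.linearMap (Algebra.linearMap ℤ ℚ)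
  have hj : Injective j := Finsupp.mapRange_injective _ (map_zero _) Int.cast_injective
  -- `K`, as a quotient of a free group, embeds in the divisible group `(K →₀ ℚ) ⧸ C`. This
  -- embedding extends to `F` by injectivity and lifts to `K →₀ ℚ` by projectivity of `F`. On `K`
  -- the lift has integral values and splits `f`.
  let C : Submodule ℤ (K →₀ ℚ) := (LinearMap.ker f).map j
  let _ : DivisibleBy ((K →₀ ℚ) ⧸ C) ℤ := divisibleByOfSMulRightSurj _ _ fun {n} hn y => by
    obtain ⟨q, rfl⟩ := C.mkQ_surjective y
    refine ⟨C.mkQ ((n : ℚ)⁻¹ • q), ?_⟩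
    change n • C.mkQ _ = _
    rw [← map_zsmul, ← Int.cast_smul_eq_zsmul ℚ, smul_inv_smul₀ (Int.cast_ne_zero.2 hn)]
  have hC : LinearMap.ker f ≤ LinearMap.ker (C.mkQ ∘ₗ j) := fun a ha => by
    rw [LinearMap.mem_ker, LinearMap.comp_apply, Submodule.mkQ_apply, Submodule.Quotient.mk_eq_zero]
    exact ⟨a, ha, rfl⟩
  let φ : K →ₗ[ℤ] ((K →₀ ℚ) ⧸ C) :=
    (LinearMap.ker f).liftQ (C.mkQ ∘ₗ j) hC ∘ₗ (f.quotKerEquivOfSurjective hf).symm.toLinearMap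
  have hφ : ∀ a, φ (f a) = C.mkQ (j a) := fun a => by
    have : (f.quotKerEquivOfSurjective hf).symm (f a) = (LinearMap.ker f).mkQ a := by
      rw [LinearEquiv.symm_apply_eq]
      rfl
    simp only [φ, LinearMap.comp_apply, LinearEquiv.coe_coe, this]
    rfl
  obtain ⟨ψ, hψ⟩ := (Module.Baer.of_divisible ((K →₀ ℚ) ⧸ C)).extension_property i hi φ
  obtain ⟨θ, hθ⟩ := Module.projective_lifting_property C.mkQ ψ C.mkQ_surjective
  have key : ∀ k, ∃ a, j a = θ (i k) ∧ f a = k := fun k => by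
    obtain ⟨a, rfl⟩ := hf k
    have h1 : C.mkQ (θ (i (f a))) = C.mkQ (j a) := by
      rw [← hφ, ← hψ, ← hθ]
      rfl
    rw [← sub_eq_zero, ← map_sub, Submodule.mkQ_apply, Submodule.Quotient.mk_eq_zero] at h1
    obtain ⟨b, hb, hb'⟩ := h1
    refine ⟨b + a, by rw [map_add, hb', sub_add_cancel], ?_⟩
    rw [map_add, show f b = 0 from hb, zero_add]
  obtain ⟨s, hs⟩ := exists_comp_eq_of_injective j hj (θ ∘ₗ i) fun k => (key k).imp fun a h => h.1
  refine ⟨s, LinearMap.ext fun k => ?_⟩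
  obtain ⟨a, ha, ha'⟩ := key k
  rw [LinearMap.comp_apply, hj ((hs k).trans ha.symm), ha', LinearMap.id_apply]

end IntegralProjective

/-! ### Diagonal tensor products and finiteness of projective dimension -/

section DiagonalAction

open MonoidAlgebra TensorProduct

variable {G : Type u} [Group G]

/-- Additive maps commuting with the action of the group are linear over the group ring. -/
def linearOfEquivariant {M N : Type*} [AddCommGroup M] [AddCommGroup N]
    [Module (MonoidAlgebra ℤ G) M] [Module (MonoidAlgebra ℤ G) N] (f : M →+ N)
    (hf : ∀ (g : G) (m : M), f ((single g 1 : MonoidAlgebra ℤ G) • m) =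
      (single g 1 : MonoidAlgebra ℤ G) • f m) : M →ₗ[MonoidAlgebra ℤ G] N where
  toFun := f
  map_add' := map_add f
  map_smul' a m := by
    induction a using induction_linear with
    | zero => simp
    | add a b ha hb => simp only [add_smul, map_add, ha, hb]
    | single g n =>
      have : (single g n : MonoidAlgebra ℤ G) = n • single g 1 := by simp
      rw [this, smul_assoc, map_zsmul, hf, RingHom.id_apply, smul_assoc]

/-- The action of `G` on a `ℤ[G]`-module. -/
noncomputable def toRep (G : Type u) [Group G] (M : Type*) [AddCommGroup M] [Module (MonoidAlgebra ℤ G) M] : Representation ℤ G M where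
  toFun g :=
    { toFun := fun m => (single g 1 : MonoidAlgebra ℤ G) • m
      map_add' := smul_add _
      map_smul' := fun n m => smul_comm _ _ _ }
  map_one' := LinearMap.ext fun m => one_smul _ m
  map_mul' g h := LinearMap.ext fun m => by
    change (single (g * h) 1 : MonoidAlgebra ℤ G) • m =
      (single g 1 : MonoidAlgebra ℤ G) • (single h 1 : MonoidAlgebra ℤ G) • m
    rw [← mul_smul, single_mul_single, one_mul]

/-- The tensor product of two `ℤ[G]`-modules over `ℤ`, with the diagonal action. -/
noncomputable def diagTensor (M K : ModuleCat.{u} (MonoidAlgebra ℤ G)) :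
    ModuleCat.{u} (MonoidAlgebra ℤ G) :=
  ModuleCat.of _ (Representation.tprod (toRep G M) (toRep G K)).asModule

/-- The group of additive maps between two `ℤ[G]`-modules, with the conjugation action. -/
noncomputable def diagHom (M K : ModuleCat.{u} (MonoidAlgebra ℤ G)) :
    ModuleCat.{u} (MonoidAlgebra ℤ G) :=
  ModuleCat.of _ (Representation.linHom (toRep G M) (toRep G K)).asModule

/-- The identity map from the tensor product to the module with the diagonal action. -/
def toDiagTensor (M K : ModuleCat.{u} (MonoidAlgebra ℤ G)) : (M ⊗[ℤ] K) ≃+ diagTensor M K :=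
  AddEquiv.refl _

/-- The identity map from the additive maps to the module with the conjugation action. -/
def toDiagHom (M K : ModuleCat.{u} (MonoidAlgebra ℤ G)) : (M →ₗ[ℤ] K) ≃+ diagHom M K :=
  AddEquiv.refl _

lemma single_smul_toDiagTensor (M K : ModuleCat.{u} (MonoidAlgebra ℤ G)) (g : G) (m : M) (k : K) :
    (single g 1 : MonoidAlgebra ℤ G) • toDiagTensor M K (m ⊗ₜ k) =
      toDiagTensor M K (((single g 1 : MonoidAlgebra ℤ G) • m) ⊗ₜ
        ((single g 1 : MonoidAlgebra ℤ G) • k)) :=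
  (Representation.single_smul (Representation.tprod (toRep G M) (toRep G K)) 1 g _).trans
    (one_smul ℤ _)

lemma single_smul_toDiagHom (M K : ModuleCat.{u} (MonoidAlgebra ℤ G)) (g : G) (f : M →ₗ[ℤ] K) :
    (single g 1 : MonoidAlgebra ℤ G) • toDiagHom M K f =
      toDiagHom M K (toRep G K g ∘ₗ f ∘ₗ toRep G M g⁻¹) :=
  (Representation.single_smul (Representation.linHom (toRep G M) (toRep G K)) 1 g _).trans
    (one_smul ℤ _)

lemma diagTensor_induction {M K : ModuleCat.{u} (MonoidAlgebra ℤ G)} {p : diagTensor M K → Prop}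
    (x : diagTensor M K) (h0 : p 0) (ht : ∀ m k, p (toDiagTensor M K (m ⊗ₜ k)))
    (ha : ∀ x y, p x → p y → p (x + y)) : p x :=
  TensorProduct.induction_on (motive := fun x => p (toDiagTensor M K x)) x h0 ht
    fun _ _ => ha _ _

/-- An additive map out of the tensor product that is equivariant on pure tensors. -/
noncomputable def linearOfDiagTensor {M K N : ModuleCat.{u} (MonoidAlgebra ℤ G)}
    (f : (M ⊗[ℤ] K) →ₗ[ℤ] N) (hf : ∀ (g : G) (m : M) (k : K),
      f (((single g 1 : MonoidAlgebra ℤ G) • m) ⊗ₜ ((single g 1 : MonoidAlgebra ℤ G) • k)) =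
        (single g 1 : MonoidAlgebra ℤ G) • f (m ⊗ₜ k)) :
    diagTensor M K →ₗ[MonoidAlgebra ℤ G] N :=
  linearOfEquivariant (f.toAddMonoidHom.comp (toDiagTensor M K).symm.toAddMonoidHom) fun g x => by
    induction x using diagTensor_induction with
    | h0 => simp
    | ht m k =>
      rw [single_smul_toDiagTensor]
      exact hf g m k
    | ha x y hx hy => rw [smul_add, map_add, hx, hy, map_add, smul_add]

/-- The map of diagonal tensor products induced by a map of the first factors. -/
noncomputable def diagTensorMap {M N : ModuleCat.{u} (MonoidAlgebra ℤ G)}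
    (f : M →ₗ[MonoidAlgebra ℤ G] N) (K : ModuleCat.{u} (MonoidAlgebra ℤ G)) :
    diagTensor M K →ₗ[MonoidAlgebra ℤ G] diagTensor N K :=
  linearOfDiagTensor
    ((toDiagTensor N K).toAddMonoidHom.toIntLinearMap ∘ₗ
      f.toAddMonoidHom.toIntLinearMap.rTensor K) fun g m k => by
    refine Eq.trans ?_ (single_smul_toDiagTensor N K g (f m) k).symm
    exact congrArg (fun n => toDiagTensor N K (n ⊗ₜ _)) (map_smul f _ m)

/-- By adjunction, equivariant maps out of `P ⊗ K` are equivariant maps from `P` to `Hom(K, -)`.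
Projectivity of `K` over `ℤ` makes `Hom(K, -)` preserve surjections, and then projectivity of `P`
gives the lift. -/
lemma projective_diagTensor {P K : ModuleCat.{u} (MonoidAlgebra ℤ G)}
    [Module.Projective (MonoidAlgebra ℤ G) P] [Module.Projective ℤ K] :
    Module.Projective (MonoidAlgebra ℤ G) (diagTensor P K) := by
  refine .of_lifting_property'' fun f hf => ?_
  let T := diagTensor P K
  let F : ModuleCat.{u} (MonoidAlgebra ℤ G) := ModuleCat.of _ (T →₀ MonoidAlgebra ℤ G)
  let f₀ : F →ₗ[ℤ] T := f.toAddMonoidHom.toIntLinearMap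
  let post : diagHom K F →ₗ[MonoidAlgebra ℤ G] diagHom K T :=
    linearOfEquivariant ((toDiagHom K T).toAddMonoidHom.comp
      ((LinearMap.compRight ℤ f₀).toAddMonoidHom.comp
        (toDiagHom K F).symm.toAddMonoidHom)) fun g h => by
      refine Eq.trans ?_ (single_smul_toDiagHom K T g (f₀ ∘ₗ (toDiagHom K F).symm h)).symm
      have h1 : (toDiagHom K F).symm ((single g 1 : MonoidAlgebra ℤ G) • h) =
          toRep G F g ∘ₗ (toDiagHom K F).symm h ∘ₗ toRep G K g⁻¹ :=
        congrArg (toDiagHom K F).symm (single_smul_toDiagHom K F g ((toDiagHom K F).symm h))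
      refine (congrArg (fun h => toDiagHom K T (f₀ ∘ₗ h)) h1).trans ?_
      refine congrArg (toDiagHom K T) (LinearMap.ext fun k => ?_)
      exact map_smul f (single g 1 : MonoidAlgebra ℤ G) _
  have hpost : Surjective post := fun h => by
    obtain ⟨h', hh⟩ := Module.projective_lifting_property f₀ ((toDiagHom K T).symm h) hf
    exact ⟨toDiagHom K F h', congrArg (toDiagHom K T) hh⟩
  let unit : P →ₗ[MonoidAlgebra ℤ G] diagHom K T :=
    linearOfEquivariant ((toDiagHom K T).toAddMonoidHom.comp
      ((LinearMap.compRight ℤ (toDiagTensor P K).toAddMonoidHom.toIntLinearMap).toAddMonoidHom.comp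
        (TensorProduct.mk ℤ P K).toAddMonoidHom)) fun g p => by
      refine Eq.trans ?_ (single_smul_toDiagHom K T g _).symm
      refine congrArg (toDiagHom K T) (LinearMap.ext fun k => ?_)
      refine Eq.trans ?_ (single_smul_toDiagTensor P K g p (toRep G K g⁻¹ k)).symm
      refine congrArg (fun k => toDiagTensor P K (_ ⊗ₜ k)) ?_
      exact ((toRep G K).self_inv_apply g k).symm
  obtain ⟨h, hh⟩ := Module.projective_lifting_property post unit hpost
  let h₀ : P →ₗ[ℤ] K →ₗ[ℤ] F :=
    ((toDiagHom K F).symm.toAddMonoidHom.comp h.toAddMonoidHom).toIntLinearMap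
  have hh₀ : ∀ p k, f (h₀ p k) = toDiagTensor P K (p ⊗ₜ k) := fun p k =>
    LinearMap.congr_fun (congrArg (toDiagHom K T).symm (LinearMap.congr_fun hh p)) k
  refine ⟨linearOfDiagTensor (N := F) (TensorProduct.lift h₀) fun g p k => ?_,
    LinearMap.ext fun x => ?_⟩
  · have h1 : h₀ ((single g 1 : MonoidAlgebra ℤ G) • p) =
        toRep G F g ∘ₗ h₀ p ∘ₗ toRep G K g⁻¹ :=
      congrArg (toDiagHom K F).symm ((map_smul h (single g 1 : MonoidAlgebra ℤ G) p).trans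
        (single_smul_toDiagHom K F g (h₀ p)))
    refine (TensorProduct.lift.tmul _ _).trans ((LinearMap.congr_fun h1 _).trans ?_)
    exact congrArg (fun k => (single g 1 : MonoidAlgebra ℤ G) • h₀ p k)
      ((toRep G K).inv_self_apply g k)
  · induction x using diagTensor_induction with
    | h0 => simp
    | ht p k => exact hh₀ p k
    | ha x y hx hy => rw [map_add, hx, hy, map_add]

/-- Since `K` is flat over `ℤ`, the resolution stays exact after tensoring, and its terms stay
projective. -/
lemma hasProjectiveDimensionLT_diagTensor {l : List ℕ}
    {M K : ModuleCat.{u} (MonoidAlgebra ℤ G)} [Module.Projective ℤ K]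
    (h : FinRes (finProj _) l M) : HasProjectiveDimensionLT (diagTensor M K) l.length := by
  induction h with
  | @nil M h =>
    have : Subsingleton (diagTensor M K) := subsingleton_of_forall_eq 0 fun x => by
      induction x using diagTensor_induction with
      | h0 => rfl
      | ht m k => rw [Subsingleton.elim m 0, TensorProduct.zero_tmul, map_zero]
      | ha x y hx hy => rw [hx, hy, add_zero]
    exact hasProjectiveDimensionLT_of_subsingleton _
  | @cons k l L P M i f hi hif hf hP hK ih =>
    obtain ⟨-, hP, -⟩ := hP
    exact hasProjectiveDimensionLT_succ_of_exact (diagTensorMap i K) (diagTensorMap f K)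
      (Module.Flat.rTensor_preserves_injective_linearMap (M := K)
        i.toAddMonoidHom.toIntLinearMap hi)
      (rTensor_exact (R := ℤ) (f := i.toAddMonoidHom.toIntLinearMap)
        (g := f.toAddMonoidHom.toIntLinearMap) K hif hf)
      (LinearMap.rTensor_surjective (g := f.toAddMonoidHom.toIntLinearMap) K hf) ih
      projective_diagTensor

/-- Tensoring with the trivial module does nothing. -/
noncomputable def diagTensorTrivial (K : ModuleCat.{u} (MonoidAlgebra ℤ G)) :
    diagTensor (trivialModule G) K ≃ₗ[MonoidAlgebra ℤ G] K :=
  let e : ((ULift.{u} ℤ) ⊗[ℤ] K) ≃ₗ[ℤ] K :=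
    (TensorProduct.congr ULift.moduleEquiv (.refl ℤ K)).trans (TensorProduct.lid ℤ K)
  LinearEquiv.ofBijective (linearOfDiagTensor (M := trivialModule G) e.toLinearMap fun g m k => by
    rw [single_smul_trivialModule, one_smul]
    exact smul_comm (ULift.down m) (single g 1 : MonoidAlgebra ℤ G) k) e.bijective

/-- Over the group ring of a group of finite cohomological dimension, all modules have finite
projective dimension. -/
lemma hasProjectiveDimensionLT_of_finRes {l : List ℕ} (h : FinRes (finProj _) l (trivialModule G))
    (N : ModuleCat.{u} (MonoidAlgebra ℤ G)) : HasProjectiveDimensionLT N (l.length + 1) := by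
  -- `N` itself need not be projective over `ℤ`, but the kernel of a free cover is. This step
  -- accounts for the `+ 1` in the bound.
  obtain ⟨P, K, i, f, hi, hif, hf, hP, hP'⟩ : ∃ (P K : ModuleCat.{u} (MonoidAlgebra ℤ G))
      (i : K →ₗ[MonoidAlgebra ℤ G] P) (f : P →ₗ[MonoidAlgebra ℤ G] N), Injective i ∧ Exact i f ∧
      Surjective f ∧ Module.Projective (MonoidAlgebra ℤ G) P ∧ Module.Projective ℤ P := by
    let p : (N →₀ MonoidAlgebra ℤ G) →ₗ[MonoidAlgebra ℤ G] N := Finsupp.linearCombination _ id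
    refine ⟨ModuleCat.of _ (N →₀ MonoidAlgebra ℤ G), ModuleCat.of _ (LinearMap.ker p),
      (LinearMap.ker p).subtype, p, Subtype.val_injective, LinearMap.exact_subtype_ker_map _,
      Finsupp.linearCombination_surjective _ surjective_id, ?_, ?_⟩
    · exact inferInstanceAs (Module.Projective _ (N →₀ MonoidAlgebra ℤ G))
    · have : Module.Free ℤ (MonoidAlgebra ℤ G) := inferInstance
      have : Module.Projective ℤ (N →₀ MonoidAlgebra ℤ G) := inferInstance
      convert this
  have : Module.Projective ℤ K := projective_int_of_injective i.toAddMonoidHom.toIntLinearMap hi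
  have h1 := hasProjectiveDimensionLT_diagTensor (K := K) h
  have h2 : HasProjectiveDimensionLT K l.length :=
    hasProjectiveDimensionLT_of_iso (diagTensorTrivial K).toModuleIso _
  exact hasProjectiveDimensionLT_succ_of_exact i f hi hif hf h2 hP

end DiagonalAction

/-! ### Coinvariants, ranks and the Euler sum -/

section Rank

open MonoidAlgebra

variable {G : Type u} [Group G]

/-- The subgroup of `P` generated by all `g p - p`. -/
abbrev augSub (P : ModuleCat.{u} (MonoidAlgebra ℤ G)) : Submodule ℤ P :=
  Submodule.span ℤ {x : P | ∃ (g : G) (p : P), x = MonoidAlgebra.of ℤ G g • p - p}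

/-- The augmentation of the group ring. -/
noncomputable def augmentation (G : Type u) [Group G] : MonoidAlgebra ℤ G →ₐ[ℤ] ℤ :=
  MonoidAlgebra.lift ℤ ℤ G 1

lemma augmentation_single (g : G) (n : ℤ) : augmentation G (single g n) = n := by
  simp [augmentation]

lemma mkQ_smul (P : ModuleCat.{u} (MonoidAlgebra ℤ G)) (a : MonoidAlgebra ℤ G) (p : P) :
    (augSub P).mkQ (a • p) = augmentation G a • (augSub P).mkQ p := by
  induction a using induction_linear with
  | zero => simp
  | add a b ha hb => rw [add_smul, map_add, ha, hb, map_add, add_smul]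
  | single g n =>
    have : (single g n : MonoidAlgebra ℤ G) = n • single g 1 := by simp
    rw [this, smul_assoc, map_zsmul, map_zsmul, augmentation_single, smul_assoc, one_smul]
    congr 1
    rw [← sub_eq_zero, ← map_sub, Submodule.mkQ_apply, Submodule.Quotient.mk_eq_zero]
    exact Submodule.subset_span ⟨g, p, rfl⟩

/-- A spanning family gives a spanning family of the coinvariants. -/
lemma surjective_sum_mkQ {k : ℕ} {P : ModuleCat.{u} (MonoidAlgebra ℤ G)}
    (f : (Fin k → MonoidAlgebra ℤ G) →ₗ[MonoidAlgebra ℤ G] P) (hf : Surjective f) :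
    Surjective (Fintype.linearCombination ℤ
      fun i => (augSub P).mkQ (f (Pi.single i 1)) : (Fin k → ℤ) →ₗ[ℤ] P ⧸ augSub P) := fun y => by
  obtain ⟨p, rfl⟩ := (augSub P).mkQ_surjective y
  obtain ⟨a, rfl⟩ := hf p
  refine ⟨fun i => augmentation G (a i), ?_⟩
  rw [Fintype.linearCombination_apply]
  conv_rhs => rw [pi_eq_sum_univ' a, map_sum, map_sum]
  refine Finset.sum_congr rfl fun i _ => ?_
  rw [map_smul, mkQ_smul]

lemma finite_coinvariants {P : ModuleCat.{u} (MonoidAlgebra ℤ G)}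
    [Module.Finite (MonoidAlgebra ℤ G) P] : Module.Finite ℤ (P ⧸ augSub P) := by
  obtain ⟨k, f, hf⟩ := Module.Finite.exists_fin' (MonoidAlgebra ℤ G) P
  exact Module.Finite.of_surjective _ (surjective_sum_mkQ f hf)

lemma augSub_le_comap {P Q : ModuleCat.{u} (MonoidAlgebra ℤ G)}
    (f : P →ₗ[MonoidAlgebra ℤ G] Q) :
    augSub P ≤ (augSub Q).comap f.toAddMonoidHom.toIntLinearMap := by
  rw [Submodule.span_le]
  rintro _ ⟨g, p, rfl⟩
  exact Submodule.subset_span ⟨g, f p, (map_sub f _ _).trans (by rw [map_smul])⟩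

/-- The map induced on coinvariants. -/
noncomputable def coinvMap {P Q : ModuleCat.{u} (MonoidAlgebra ℤ G)} (f : P →ₗ[MonoidAlgebra ℤ G] Q) :
    (P ⧸ augSub P) →ₗ[ℤ] (Q ⧸ augSub Q) :=
  (augSub P).mapQ (augSub Q) f.toAddMonoidHom.toIntLinearMap (augSub_le_comap f)

lemma coinvMap_mkQ {P Q : ModuleCat.{u} (MonoidAlgebra ℤ G)} (f : P →ₗ[MonoidAlgebra ℤ G] Q)
    (p : P) : coinvMap f ((augSub P).mkQ p) = (augSub Q).mkQ (f p) := rfl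

lemma groupRingRank_congr {P Q : ModuleCat.{u} (MonoidAlgebra ℤ G)}
    (e : P ≃ₗ[MonoidAlgebra ℤ G] Q) : groupRingRank P = groupRingRank Q := by
  refine LinearEquiv.finrank_eq (LinearEquiv.ofLinearMap (coinvMap e.toLinearMap)
    (coinvMap e.symm.toLinearMap) ?_ ?_)
  · refine Submodule.linearMap_qext _ (LinearMap.ext fun p => ?_)
    simp [coinvMap_mkQ, -Submodule.mkQ_apply]
  · refine Submodule.linearMap_qext _ (LinearMap.ext fun p => ?_)
    simp [coinvMap_mkQ, -Submodule.mkQ_apply]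

/-- Coinvariants preserve split exact sequences. Finiteness matters because `finrank` is `0` in
infinite rank. -/
lemma groupRingRank_prod (P Q : ModuleCat.{u} (MonoidAlgebra ℤ G))
    [Module.Finite (MonoidAlgebra ℤ G) P] [Module.Finite (MonoidAlgebra ℤ G) Q] :
    groupRingRank (ModuleCat.of (MonoidAlgebra ℤ G) (P × Q)) =
      groupRingRank P + groupRingRank Q := by
  let T : ModuleCat.{u} (MonoidAlgebra ℤ G) := ModuleCat.of (MonoidAlgebra ℤ G) (P × Q)
  let inl : P →ₗ[MonoidAlgebra ℤ G] T := LinearMap.inl _ P Q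
  let inr : Q →ₗ[MonoidAlgebra ℤ G] T := LinearMap.inr _ P Q
  let fst : T →ₗ[MonoidAlgebra ℤ G] P := LinearMap.fst _ P Q
  let snd : T →ₗ[MonoidAlgebra ℤ G] Q := LinearMap.snd _ P Q
  have := finite_coinvariants (P := P)
  have : Module.Finite (MonoidAlgebra ℤ G) T :=
    inferInstanceAs (Module.Finite (MonoidAlgebra ℤ G) (P × Q))
  have := finite_coinvariants (P := T)
  have h1 : ∀ x, coinvMap fst (coinvMap inl x) = x := fun x => by
    obtain ⟨p, rfl⟩ := (augSub P).mkQ_surjective x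
    rfl
  have h2 : ∀ x, coinvMap snd (coinvMap inr x) = x := fun x => by
    obtain ⟨p, rfl⟩ := (augSub Q).mkQ_surjective x
    rfl
  have h3 : ∀ x, coinvMap snd (coinvMap inl x) = 0 := fun x => by
    obtain ⟨p, rfl⟩ := (augSub P).mkQ_surjective x
    exact map_zero (augSub Q).mkQ
  have h4 : ∀ x, coinvMap inl (coinvMap fst x) + coinvMap inr (coinvMap snd x) = x := fun x => by
    obtain ⟨⟨p, q⟩, rfl⟩ := (augSub T).mkQ_surjective x
    simp only [coinvMap_mkQ]
    rw [← map_add]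
    exact congrArg _ (show ((p, 0) : P × Q) + (0, q) = (p, q) by simp)
  have hker : LinearMap.ker (coinvMap snd) = LinearMap.range (coinvMap inl) := by
    ext x
    constructor
    · intro hx
      refine ⟨coinvMap fst x, ?_⟩
      conv_rhs => rw [← h4 x, show coinvMap snd x = 0 from hx, map_zero, add_zero]
    · rintro ⟨y, rfl⟩
      exact h3 y
  have e1 : (P ⧸ augSub P) ≃ₗ[ℤ] LinearMap.ker (coinvMap snd) :=
    (LinearEquiv.ofInjective (coinvMap inl) (LeftInverse.injective h1)).trans
      (LinearEquiv.ofEq _ _ hker.symm)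
  have e2 : ((T ⧸ augSub T) ⧸ LinearMap.ker (coinvMap snd)) ≃ₗ[ℤ] (Q ⧸ augSub Q) :=
    (coinvMap snd).quotKerEquivOfSurjective fun y => ⟨_, h2 y⟩
  have := Submodule.finrank_quotient_add_finrank (LinearMap.ker (coinvMap snd))
  rw [← e1.finrank_eq, e2.finrank_eq, add_comm] at this
  exact this.symm

/-- Applying the augmentation to each coordinate inverts the map from `ℤᵏ` to the coinvariants given
by the basis. -/
lemma groupRingRank_of_finFree {k : ℕ} {P : ModuleCat.{u} (MonoidAlgebra ℤ G)}
    (h : finFree _ k P) : groupRingRank P = k := by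
  obtain ⟨e⟩ := h
  let s := Fintype.linearCombination ℤ fun i => (augSub P).mkQ (e.symm (Pi.single i 1))
  have hs : Surjective s := surjective_sum_mkQ e.symm.toLinearMap e.symm.surjective
  let t₀ : P →ₗ[ℤ] (Fin k → ℤ) :=
    LinearMap.pi fun i => ((augmentation G).toLinearMap.toAddMonoidHom.comp
      ((LinearMap.proj i).comp e.toLinearMap).toAddMonoidHom).toIntLinearMap
  have ht₀ : ∀ p i, t₀ p i = augmentation G (e p i) := fun _ _ => rfl
  let t : (P ⧸ augSub P) →ₗ[ℤ] (Fin k → ℤ) := (augSub P).liftQ t₀ <| by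
    rw [Submodule.span_le]
    rintro _ ⟨g, p, rfl⟩
    refine funext fun i => ?_
    rw [ht₀]
    simp [augmentation_single]
  have hts : ∀ z, t (s z) = z := by
    refine LinearMap.congr_fun (f := t ∘ₗ s) (g := LinearMap.id) ?_
    refine LinearMap.pi_ext' fun i => LinearMap.ext_ring ?_
    refine funext fun j => ?_
    have h1 : s (Pi.single i 1) = (augSub P).mkQ (e.symm (Pi.single i 1)) := by
      simp [s, Fintype.linearCombination_apply_single]
    change t (s (Pi.single i 1)) j = (Pi.single i 1 : Fin k → ℤ) j
    rw [h1]
    change t₀ (e.symm (Pi.single i 1)) j = _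
    rw [ht₀, e.apply_symm_apply]
    by_cases hij : j = i
    · subst hij
      simp
    · simp [hij]
  have e' := LinearEquiv.ofBijective s ⟨LeftInverse.injective hts, hs⟩
  change Module.finrank ℤ (P ⧸ augSub P) = k
  rw [← e'.finrank_eq]
  simp

/-- The class of finitely generated projective modules with the rank over the group ring. -/
def finProjRank (G : Type u) [Group G] (k : ℕ) (P : ModuleCat.{u} (MonoidAlgebra ℤ G)) : Prop :=
  Module.Projective (MonoidAlgebra ℤ G) P ∧ Module.Finite (MonoidAlgebra ℤ G) P ∧
    groupRingRank P = k

lemma finFree.finProjRank {k : ℕ} {P : ModuleCat.{u} (MonoidAlgebra ℤ G)} (h : finFree _ k P) :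
    finProjRank G k P :=
  ⟨isRankedClass_finFree.projective h, isRankedClass_finFree.finite h, groupRingRank_of_finFree h⟩

lemma isRankedClass_finProjRank : IsRankedClass (finProjRank G) where
  projective h := h.1
  finite h := h.2.1
  prod h h' := by
    obtain ⟨_, _, rfl⟩ := h
    obtain ⟨_, _, rfl⟩ := h'
    exact ⟨inferInstance, inferInstance, groupRingRank_prod _ _⟩
  congr e h := by
    obtain ⟨_, _, rfl⟩ := h
    exact ⟨.of_equiv e, .equiv e, (groupRingRank_congr e).symm⟩
  zero := finFree.finProjRank isRankedClass_finFree.zero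

lemma evenSum_map_range (n : ℕ) (f : ℕ → ℕ) :
    evenSum ((List.range n).map f) = ∑ i ∈ Finset.range n with Even i, f i ∧
      oddSum ((List.range n).map f) = ∑ i ∈ Finset.range n with Odd i, f i := by
  simp only [Finset.sum_filter]
  induction n generalizing f with
  | zero => exact ⟨rfl, rfl⟩
  | succ n ih =>
    obtain ⟨h1, h2⟩ := ih (f ∘ Nat.succ)
    rw [List.range_succ_eq_map, List.map_cons, List.map_map, evenSum_cons, oddSum_cons, h1, h2,
      Finset.sum_range_succ', Finset.sum_range_succ']
    simp [Nat.even_add_one, Nat.odd_add_one, add_comm]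

lemma eulerSum_eq (P : ProjectiveResolution (trivialModule G)) (n : ℕ) (hn : LengthLE P n) :
    eulerSum P = evenSum ((List.range (n + 1)).map fun i => groupRingRank (P.complex.X i)) -
      oddSum ((List.range (n + 1)).map fun i => groupRingRank (P.complex.X i)) := by
  have hsupp : (support fun i : ℕ => (-1 : ℤ) ^ i * (groupRingRank (P.complex.X i) : ℤ)) ⊆
      (Finset.range (n + 1) : Finset ℕ) := fun i hi => by
    by_contra h
    have := ModuleCat.subsingleton_of_isZero (hn i (by simpa using h))
    refine hi ?_
    have : groupRingRank (P.complex.X i) = 0 :=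
      groupRingRank_of_finFree ⟨LinearEquiv.ofBijective 0 ⟨injective_of_subsingleton _,
        fun _ => ⟨0, Subsingleton.elim _ _⟩⟩⟩
    simp [this]
  rw [eulerSum, finsum_eq_sum_of_support_subset _ hsupp, (evenSum_map_range _ _).1,
    (evenSum_map_range _ _).2, Finset.sum_filter, Finset.sum_filter, Nat.cast_sum, Nat.cast_sum,
    ← Finset.sum_sub_distrib]
  refine Finset.sum_congr rfl fun i _ => ?_
  rcases Nat.even_or_odd i with h | h
  · simp [h, h.neg_one_pow, Nat.not_odd_iff_even.2 h]
  · simp [h, h.neg_one_pow, Nat.not_even_iff_odd.2 h]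

end Rank

/-! ### Assembly of the theorem -/

section Main

variable {G : Type u} [Group G]

lemma finRes_of_isFreeOfRanks {A : Type u} [Ring A] {N : ModuleCat.{u} A}
    (F : ProjectiveResolution N) {rk : ℕ → ℕ} (hF : IsFreeOfRanks F rk) {n : ℕ}
    (hn : LengthLE F n) : FinRes (finFree A) ((List.range (n + 1)).map rk) N :=
  .of_seqRes (Φ := finFree A) (.ofProjectiveResolution F) rk hF n fun j hj =>
    ModuleCat.subsingleton_of_isZero (hn j hj)

lemma isFiniteType_toProjectiveResolution {A : Type u} [Ring A] {N : ModuleCat.{u} A}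
    (S : SeqRes N) (hS : ∀ j, Module.Projective A (S.X j)) (hS' : ∀ j, Module.Finite A (S.X j)) :
    IsFiniteType (S.toProjectiveResolution hS) := hS'

lemma TypeFP.exists_finRes (hG : TypeFP G) :
    ∃ l, FinRes (finProj _) l (trivialModule G) := by
  obtain ⟨P, hP, n, hn⟩ := hG
  exact ⟨_, .of_seqRes (.ofProjectiveResolution P) (fun _ => 0)
    (fun j => ⟨rfl, (IsProjective.iff_projective _).2 (P.projective j), hP j⟩) n fun j hj =>
      ModuleCat.subsingleton_of_isZero (hn j hj)⟩

/-- The trivial module of `G` is the restriction of that of `G / ⟨c⟩`. -/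
noncomputable def trivialModuleEquiv (c : Subgroup.center G) :
    trivialModule G ≃ₗ[MonoidAlgebra ℤ G] restrict c (trivialModule (CQuot G c)) :=
  let f : trivialModule G →ₗ[MonoidAlgebra ℤ G] restrict c (trivialModule (CQuot G c)) :=
    linearOfEquivariant (AddMonoidHom.id (ULift.{u} ℤ)) fun g m => by
      refine (single_smul_trivialModule g 1 m).trans ?_
      refine (single_smul_trivialModule (g : CQuot G c) 1 m).symm.trans ?_
      let m' : trivialModule (CQuot G c) := (m : ULift.{u} ℤ)
      exact congrArg (fun a : MonoidAlgebra ℤ (CQuot G c) => a • m')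
        (groupRingProj_single c g 1).symm
  LinearEquiv.ofBijective f bijective_id

lemma subOne_smul_restrict (c : Subgroup.center G)
    (N : ModuleCat.{u} (MonoidAlgebra ℤ (CQuot G c))) (n : restrict c N) :
    subOne (c : G) • n = 0 := by
  change groupRingProj c (subOne (c : G)) • (show N from n) = 0
  rw [groupRingProj_subOne, zero_smul]

/-- A finite resolution over `ℤ[G]` of a module over `ℤ[G / ⟨c⟩]` gives an eventually `2`-periodic
resolution over `ℤ[G / ⟨c⟩]`. -/
lemma exists_periodic_quotient {c : Subgroup.center G} (hc : ¬ IsOfFinOrder (c : G))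
    {Φ : ℕ → ModuleCat.{u} (MonoidAlgebra ℤ G) → Prop}
    {Ψ : ℕ → ModuleCat.{u} (MonoidAlgebra ℤ (CQuot G c)) → Prop} (hΦ : IsRankedClass Φ)
    (hrank : ∀ {k l : ℕ} {P Q : ModuleCat.{u} (MonoidAlgebra ℤ G)}, Φ k P → Φ l Q →
      ∀ (f : P →ₗ[MonoidAlgebra ℤ G] Q) (g : Q →ₗ[MonoidAlgebra ℤ G] P),
        (∀ p, g (f p) = subOne (c : G) • p) → (∀ q, f (g q) = subOne (c : G) • q) → k = l)
    (hΨ : ∀ {k} {P : ModuleCat.{u} (MonoidAlgebra ℤ G)}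
      {D : ModuleCat.{u} (MonoidAlgebra ℤ (CQuot G c))}, Φ k P →
        (restrict c D ≃ₗ[MonoidAlgebra ℤ G] reduction (subOne (c : G)) (mul_subOne c.2) P) →
          Ψ k D)
    {N : ModuleCat.{u} (MonoidAlgebra ℤ (CQuot G c))} {l : List ℕ} (hl : 2 ≤ l.length)
    (h : FinRes Φ l (restrict c N)) :
    evenSum l = oddSum l ∧ ∃ (S : SeqRes N) (rk : ℕ → ℕ), S.IsPeriodicFrom (l.length - 2) ∧
      (∀ j, Ψ (rk j) (S.X j)) ∧ ∀ j, l.length - 2 ≤ j → rk j = evenSum l := by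
  obtain _ | ⟨a, _ | ⟨b, l⟩⟩ := l
  · simp at hl
  · simp at hl
  obtain ⟨heo, S, rk, hS, hterms, hrk⟩ := h.exists_periodic hΦ (mul_subOne c.2)
    (fun a => eq_zero_of_subOne_mul_eq_zero hc) hrank (subOne_smul_restrict c N)
  -- The terms are reductions modulo `c - 1`, which generates the kernel of `ℤG → ℤΓ`, so the whole
  -- resolution descends to `ℤΓ`.
  have hker : ∀ j a, groupRingProj c a = 0 → ∀ m : S.X j, a • m = 0 := by
    intro j a ha m
    obtain ⟨y, rfl⟩ := (groupRingProj_eq_zero_iff c a).1 ha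
    obtain ⟨P, -, ⟨e⟩⟩ := hterms j
    rw [← mul_subOne c.2, mul_smul]
    have : subOne (c : G) • m = 0 := e.injective (by
      rw [map_smul, smul_reduction (subOne (c : G)) (mul_subOne c.2) P, map_zero])
    rw [this, smul_zero]
  refine ⟨heo, S.descend (groupRingProj_surjective c) hker, rk,
    hS.descend (groupRingProj_surjective c) hker, fun j => ?_, hrk⟩
  obtain ⟨P, hP, ⟨e⟩⟩ := hterms j
  exact hΨ hP ((descendEquiv (groupRingProj_surjective c) _ (hker j)).symm.trans e)

/-- Modules of type `FP_∞` over `ℤ[G / ⟨c⟩]` have eventually `2`-periodic resolutions. -/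
lemma exists_periodic_projectiveResolution (hG : TypeFP G) {c : Subgroup.center G} (hc : c ≠ 1)
    {N : ModuleCat.{u} (MonoidAlgebra ℤ (CQuot G c))} (hN : TypeFPInfty N) :
    projectiveDimension (restrict c N) ≠ ⊤ ∧
      ∃ M : ProjectiveResolution N, IsFiniteType M ∧
        ∀ n : ℕ, projectiveDimension (restrict c N) ≤ n → IsTwoPeriodicFrom M.complex (n - 1) := by
  obtain ⟨l₀, hl₀⟩ := hG.exists_finRes
  have hinf := not_isOfFinOrder hc hl₀
  have hpd : ∃ n, HasProjectiveDimensionLE (restrict c N) n :=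
    ⟨_, hasProjectiveDimensionLT_of_finRes hl₀ _⟩
  refine ⟨(projectiveDimension_ne_top_iff _).2 hpd, ?_⟩
  classical
  let n := Nat.find hpd
  have hn : HasProjectiveDimensionLT (restrict c N) (n + 1) := Nat.find_spec hpd
  obtain ⟨P, hP⟩ := hN
  have hfp : IsFP n (restrict c N) :=
    (IsFP.of_seqRes (.ofProjectiveResolution P)
      (fun j => (IsProjective.iff_projective _).2 (P.projective j)) hP n).restrictScalars
      (groupRingProj_surjective c) (mul_subOne c.2)
      (fun a => eq_zero_of_subOne_mul_eq_zero hinf) (groupRingProj_eq_zero_iff c)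
  obtain ⟨l, hl, -, -, hres⟩ :=
    -- The periodicity theorem needs at least two terms. For `n = 0` a zero term is added, and the
    -- period still starts at `n - 1 = 0` in truncated subtraction.
    (hfp.finRes hn).pad isRankedClass_finProj (if n = 0 then 1 else 0)
  rw [List.length_replicate] at hl
  obtain ⟨-, S, rk, hS, hterms, -⟩ := exists_periodic_quotient hinf (Ψ := finProj _)
    -- All ranks in `finProj` are `0`, so the rank condition on matrix factorizations is automatic.
    isRankedClass_finProj (fun h h' _ _ _ _ => h.1.trans h'.1.symm)
    (finProj_of_reduction (groupRingProj_surjective c) (groupRingProj_eq_zero_iff c))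
    (by split_ifs at hl <;> omega) hres
  refine ⟨S.toProjectiveResolution fun j => (hterms j).2.1,
    isFiniteType_toProjectiveResolution S _ fun j => (hterms j).2.2, fun m hm => ?_⟩
  refine (hS.mono ?_).isTwoPeriodicFrom
  have := Nat.find_min' hpd ((projectiveDimension_le_iff _ _).1 hm)
  split_ifs at hl <;> omega

/-- A finite free resolution of `ℤ` over `ℤ[G]` has as many free generators in even as in odd
degrees, and gives an eventually `2`-periodic free resolution over `ℤ[G / ⟨c⟩]`. -/
lemma exists_periodic_free (hG : TypeFP G) {c : Subgroup.center G} (hc : c ≠ 1) {l : List ℕ}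
    (hl : 2 ≤ l.length) (h : FinRes (finFree _) l (trivialModule G)) :
    evenSum l = oddSum l ∧ ∃ (S : SeqRes (trivialModule (CQuot G c))) (rk : ℕ → ℕ),
      S.IsPeriodicFrom (l.length - 2) ∧ (∀ j, finFree _ (rk j) (S.X j)) ∧
      ∀ j, l.length - 2 ≤ j → rk j = evenSum l := by
  obtain ⟨l₀, hl₀⟩ := hG.exists_finRes
  exact exists_periodic_quotient (not_isOfFinOrder hc hl₀) isRankedClass_finFree
    (fun hP hQ => finFree_rank_eq (fun h => hc (Subtype.ext h)) hP hQ)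
    (finFree_of_reduction (groupRingProj_surjective c) (groupRingProj_eq_zero_iff c)) hl
    (h.congr (trivialModuleEquiv c))

/-- A finite free resolution, padded to at least two terms, has equal even and odd ranks. Invariance
of the Euler characteristic, for the rank of coinvariants, carries this to every finite projective
resolution. -/
lemma hasEulerCharacteristic_zero (hG : TypeFP G) {c : Subgroup.center G} (hc : c ≠ 1)
    (hFL : TypeFL G) : HasEulerCharacteristic G 0 := by
  rintro P hP ⟨n, hn⟩
  obtain ⟨F, rk, hF, m, hm⟩ := hFL
  obtain ⟨l, hl, -, -, hres⟩ := (finRes_of_isFreeOfRanks F hF hm).pad isRankedClass_finFree 1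
  have heo := (exists_periodic_free hG hc (by simp [hl]) hres).1
  have hres' : FinRes (finProjRank G) l (trivialModule G) := by
    simpa using hres.mono (φ := id) fun h => finFree.finProjRank h
  have hP' : FinRes (finProjRank G)
      ((List.range (n + 1)).map fun i => groupRingRank (P.complex.X i)) (trivialModule G) :=
    .of_seqRes (.ofProjectiveResolution P) _
      (fun j => ⟨(IsProjective.iff_projective _).2 (P.projective j), hP j, rfl⟩) n fun j hj =>
        ModuleCat.subsingleton_of_isZero (hn j hj)
  have := hres'.euler_eq isRankedClass_finProjRank (fun h h' => h.2.2.symm.trans h'.2.2) hP'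
  rw [eulerSum_eq P n hn]
  omega

/-- The dimension is positive because `ℤ` is nonzero and killed by `c - 1`, whereas multiplication
by `c - 1` is injective on projective modules. -/
lemma exists_cohomologicalDimension_eq (hG : TypeFP G) {c : Subgroup.center G} (hc : c ≠ 1) :
    ∃ n : ℕ, cohomologicalDimension G = (n + 1 : ℕ) := by
  obtain ⟨l₀, hl₀⟩ := hG.exists_finRes
  have hpd : ∃ n, HasProjectiveDimensionLE (trivialModule G) n :=
    ⟨_, hasProjectiveDimensionLT_of_finRes hl₀ _⟩
  classical
  obtain hn | ⟨n, hn⟩ : Nat.find hpd = 0 ∨ ∃ n, Nat.find hpd = n + 1 := by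
    cases Nat.find hpd <;> simp
  · have h0 : HasProjectiveDimensionLT (trivialModule G) 1 := by
      simpa [hn] using Nat.find_spec hpd
    have := projective_of_hasProjectiveDimensionLT h0
    have h1 := smul_eq_zero_of_projective
      (fun a => eq_zero_of_subOne_mul_eq_zero (not_isOfFinOrder hc hl₀))
      (subOne_smul_trivialModule (c : G) (ULift.up 1 : ULift.{u} ℤ))
    exact absurd (congrArg ULift.down h1) one_ne_zero
  · refine ⟨n, le_antisymm ?_ ?_⟩
    · rw [← hn]
      exact (projectiveDimension_le_iff _ _).2 (Nat.find_spec hpd)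
    · exact (projectiveDimension_ge_iff _ _).2 (Nat.find_min hpd (by omega))

end Main

end CentralQuotient

open CentralQuotient in
theorem theorem2 (G : Type u) [Group G] (hG : TypeFP G)
    (c : Subgroup.center G) (hc : c ≠ 1) (hΓ : TypeVFP (CQuot G c)) :
    (∀ N : ModuleCat.{u} (MonoidAlgebra ℤ (CQuot G c)), TypeFPInfty N →
      projectiveDimension (restrict c N) ≠ ⊤ ∧
      ∃ M : ProjectiveResolution N, IsFiniteType M ∧
        ∀ n : ℕ, projectiveDimension (restrict c N) ≤ n → IsTwoPeriodicFrom M.complex (n - 1)) ∧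
    (TypeFL G →
      HasEulerCharacteristic G 0 ∧
      ∃ n : ℕ, cohomologicalDimension G = n ∧
        (∃ (F : ProjectiveResolution (trivialModule G)) (rk : ℕ → ℕ),
          IsFreeOfRanks F rk ∧ LengthLE F n) ∧
        ∀ (F : ProjectiveResolution (trivialModule G)) (rk : ℕ → ℕ),
          IsFreeOfRanks F rk → LengthLE F n →
          ∃ r : ℕ,
            r = ∑ i ∈ Finset.range (n + 1) with Even i, rk i ∧
            r = ∑ i ∈ Finset.range (n + 1) with Odd i, rk i ∧
            ∃ (M : ProjectiveResolution (trivialModule (CQuot G c))) (rkM : ℕ → ℕ),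
              IsFreeOfRanks M rkM ∧
              IsTwoPeriodicFrom M.complex (n - 1) ∧
              ∀ j, n - 1 ≤ j → rkM j = r) := by
  refine ⟨fun N hN => exists_periodic_projectiveResolution hG hc hN, fun hFL =>
    ⟨hasEulerCharacteristic_zero hG hc hFL, ?_⟩⟩
  obtain ⟨n, hn⟩ := exists_cohomologicalDimension_eq hG hc
  -- Here `cd(G) = n + 1`, so a resolution of that length has `n + 2` terms and the period starts at
  -- `n`.
  refine ⟨n + 1, hn, ?_, fun F rk hF hF' => ?_⟩
  · obtain ⟨F, rk, hF, m, hm⟩ := hFL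
    obtain ⟨l, hl, hres⟩ := (finRes_of_isFreeOfRanks F hF hm).exists_length_eq n
      ((projectiveDimension_le_iff _ _).1 hn.le)
    obtain ⟨S, hS, hS'⟩ := hres.exists_seqRes isRankedClass_finFree
    refine ⟨S.toProjectiveResolution fun j => isRankedClass_finFree.projective (hS j), _, hS,
      fun i hi => ?_⟩
    have := hS' i (by omega)
    exact ModuleCat.isZero_of_subsingleton (S.X i)
  · obtain ⟨heo, S, rkM, hS, hterms, hrk⟩ := exists_periodic_free hG hc (by simp)
      (finRes_of_isFreeOfRanks F hF hF')
    have hlen : ((List.range (n + 1 + 1)).map rk).length - 2 = n := by simp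
    rw [hlen] at hS hrk
    refine ⟨_, (evenSum_map_range _ _).1, heo.trans (evenSum_map_range _ _).2,
      S.toProjectiveResolution fun j => isRankedClass_finFree.projective (hterms j), rkM, hterms,
      hS.isTwoPeriodicFrom, hrk⟩
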